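/- **Theorem.** There is an absolute constant $c>0$ with the following property. Let $D,\mu,G>0$, $\mathfrak p\in(1,2]$, $0<\sigma_{\mathfrak s}\le\sigma_{\mathfrak l}$, put $d_{\mathrm{eff}}=\sigma_{\mathfrak l}^2/\sigma_{\mathfrak s}^2$, and let $d\ge d_{\mathrm{eff}}$ and $T\ge 1$ be integers. Then $$R_\star^{\mathrm{str}}\ \ge\ c\,\min\left\{\mu D^2,\ \frac{G^2}{\mu},\ \frac{\sigma_{\mathfrak s}^{4/\mathfrak p-2}\,\sigma_{\mathfrak l}^{4-4/\mathfrak p}}{\mu\,T^{2-2/\mathfrak p}}\right\},\qquad R_\star^{\mathrm{str}}:=\sup_{\mathbf g}\ \inf_{\mathbf A_{0:T}}\ \sup_{F}\ \mathbb E\left[F(\mathbf x_{T+1})-F_\star\right],\quad F_\star:=\inf_{\mathbf x\in\mathbb R^d}F(\mathbf x),$$ where the supremum over $F$, the supremum over $\mathbf g$, the infimum and the expectation are as follows. * $F$ ranges over all functions $F=f+\frac{\mu}{2}\|\cdot\|^2$ on $\mathbb R^d$ with $f:\mathbb R^d\to\mathbb R$ convex and $G$-Lipschitz (Euclidean norm)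 such that $\inf_{\mathbf x_\star\in\operatorname{argmin}F}\|\mathbf x_\star\|\le D$. * $\mathbf g$ ranges over all stochastic first-order oracles: for every convex $G$-Lipschitz $f$ and every $\mathbf x\in\mathbb R^d$, $\mathbf g(\mathbf x,f)$ is an integrable random vector in $\mathbb R^d$, whose law depends measurably on $\mathbf x$, with $\nabla f(\mathbf x):=\mathbb E[\mathbf g(\mathbf x,f)]\in\partial f(\mathbf x)$, $\mathbb E\left[|\langle\mathbf e,\mathbf g(\mathbf x,f)-\nabla f(\mathbf x)\rangle|^{\mathfrak p}\right]\le\sigma_{\mathfrak s}^{\mathfrak p}$ for all unit vectors $\mathbf e$, and $\mathbb E\left[\|\mathbf g(\mathbf x,f)-\nabla f(\mathbf x)\|^{\mathfrak p}\right]\le\sigma_{\mathfrak l}^{\mathfrak p}$. * $\mathbf A_{0:T}=(\mathbf A_0,\dots,\mathbf A_T)$ ranges over all deterministic $T$-iteration methods, i.e. measurable maps $\mathbf A_t:(\mathbb R^d)^t\to\mathbb R^d$ (which may depend on the known regularizer $\frac{\mu}{2}\|\cdot\|^2$). The method starts at $\mathbf x_1=\mathbf A_0$; for $t=1,\dots,T$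 it observes $\mathbf g_t=\mathbf g(\mathbf x_t,f)$, drawn with fresh randomness (given the past, $\mathbf g_t$ has the law of $\mathbf g(\mathbf x,f)$ at $\mathbf x=\mathbf x_t$), and sets $\mathbf x_{t+1}=\mathbf A_t(\mathbf g_1,\dots,\mathbf g_t)$. -/

import Mathlib

open MeasureTheory ProbabilityTheory
open scoped ENNReal

namespace HeavyTailLB

/-- The space `ℝ^d` with its Euclidean norm and inner product. -/
abbrev Vec (d : ℕ) : Type := EuclideanSpace ℝ (Fin d)

/-- The subdifferential `∂f(x)` of a function `f : ℝ^d → ℝ`. -/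
def subdifferential {d : ℕ} (f : Vec d → ℝ) (x : Vec d) : Set (Vec d) :=
  {s | ∀ y, f x + inner ℝ s (y - x) ≤ f y}

/-- The convex and `G`-Lipschitz functions on `ℝ^d`. -/
def cvxLipClass (d : ℕ) (G : ℝ) : Set (Vec d → ℝ) :=
  {f | ConvexOn ℝ Set.univ f ∧ ∀ x y, |f x - f y| ≤ G * ‖x - y‖}

/-- The regularizer `r(x) = (μ/2) ‖x‖²`. -/
noncomputable def reg (d : ℕ) (μ : ℝ) (x : Vec d) : ℝ := μ / 2 * ‖x‖ ^ 2

/-- The set of global minimizers of `F`. -/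
def argmin {d : ℕ} (F : Vec d → ℝ) : Set (Vec d) := {x | ∀ y, F x ≤ F y}

/-- The strongly convex class: all `F = f + (μ/2) ‖·‖²` with `f` convex and `G`-Lipschitz whose
minimizers satisfy `inf ‖x⋆‖ ≤ D`. The infimum is taken in `[0, ∞]`, so it is `∞` if there is no
minimizer. -/
def strClass (d : ℕ) (D μ G : ℝ) : Set (Vec d → ℝ) :=
  {F | (∃ f ∈ cvxLipClass d G, F = f + reg d μ) ∧
    ⨅ x ∈ argmin F, ENNReal.ofReal ‖x‖ ≤ ENNReal.ofReal D}

/-- A stochastic first-order oracle. For each `f` in the class, `law f` is a Markov kernel: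
`law f x` is the law of the random vector `g(x, f)` returned to a query at `x`. Its mean is a
subgradient of `f` at `x`, and the error `g(x, f) - ∇f(x)` has `p`-th moment at most `σs ^ p` in
every direction and at most `σl ^ p` in norm. -/
structure Oracle (d : ℕ) (G p σs σl : ℝ) where
  law : cvxLipClass d G → Kernel (Vec d) (Vec d)
  isMarkovKernel_law : ∀ f, IsMarkovKernel (law f)
  integrable_law : ∀ f x, Integrable (fun g => g) (law f x)
  mean_mem : ∀ (f : cvxLipClass d G) (x : Vec d), (∫ g, g ∂(law f x)) ∈ subdifferential f.1 x
  dir_moment_le : ∀ f x (e : Vec d), ‖e‖ = 1 →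
    ∫⁻ g, ENNReal.ofReal (|inner ℝ e (g - ∫ g', g' ∂(law f x))| ^ p) ∂(law f x)
      ≤ ENNReal.ofReal (σs ^ p)
  norm_moment_le : ∀ f x,
    ∫⁻ g, ENNReal.ofReal (‖g - ∫ g', g' ∂(law f x)‖ ^ p) ∂(law f x)
      ≤ ENNReal.ofReal (σl ^ p)

attribute [instance] Oracle.isMarkovKernel_law

/-- A deterministic method with `T` iterations: measurable maps `A_0, …, A_T`, where `A_t` sends the
first `t` observed stochastic gradients to the next point `x_{t+1}`. (The regularizer is known and
fixed, so the maps may depend on it.) -/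
structure Algorithm (d T : ℕ) where
  next : ∀ t : ℕ, t ≤ T → (Fin t → Vec d) → Vec d
  measurable_next : ∀ t (ht : t ≤ T), Measurable (next t ht)

/-- Appending a new observation to a history is measurable. -/
theorem measurable_snoc (d t : ℕ) :
    Measurable (fun z : (Fin t → Vec d) × Vec d =>
      (Fin.snoc (α := fun _ => Vec d) z.1 z.2 : Fin (t + 1) → Vec d)) := by
  refine measurable_pi_lambda _ fun i => ?_
  refine Fin.lastCases ?_ (fun j => ?_) i
  · simpa using measurable_snd
  · simpa [Function.comp_def] using (measurable_pi_apply j).comp measurable_fst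

/-- The law of the first `t` observations `(g_1, …, g_t)` when the method `A` queries an oracle with
kernel `κ`: given `g_1, …, g_t`, the next observation `g_{t+1}` has law `κ (x_{t+1})`, where
`x_{t+1} = A_t (g_1, …, g_t)`. -/
noncomputable def transcript {d T : ℕ} (A : Algorithm d T) (κ : Kernel (Vec d) (Vec d)) :
    ∀ t : ℕ, t ≤ T → Measure (Fin t → Vec d)
  | 0, _ => Measure.dirac Fin.elim0
  | t + 1, ht =>
    ((transcript A κ t (Nat.le_of_succ_le ht)) ⊗ₘ
      (κ.comap (A.next t (Nat.le_of_succ_le ht)) (A.measurable_next t _))).map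
        (fun z => (Fin.snoc (α := fun _ => Vec d) z.1 z.2 : Fin (t + 1) → Vec d))

/-- The expected error `𝔼[F(x_{T+1}) - F⋆]` in `[0, ∞]`, where `x_{T+1} = A_T (g_1, …, g_T)` and
`F⋆ = inf F`. -/
noncomputable def expectedError {d T : ℕ} (A : Algorithm d T) (κ : Kernel (Vec d) (Vec d))
    (F : Vec d → ℝ) : ℝ≥0∞ :=
  ∫⁻ h, ENNReal.ofReal (F (A.next T le_rfl h) - ⨅ x, F x) ∂(transcript A κ T le_rfl)

/-- The minimax expected error for the strongly convex class: the supremum over oracles of the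
infimum over methods of the supremum over `F = f + (μ/2) ‖·‖²` in the class of the expected error,
where the oracle answers with stochastic gradients of `f`. -/
noncomputable def minimaxErrorStr (d T : ℕ) (D μ G p σs σl : ℝ) : ℝ≥0∞ :=
  ⨆ g : Oracle d G p σs σl, ⨅ A : Algorithm d T,
    ⨆ f : cvxLipClass d G, ⨆ _ : (f : Vec d → ℝ) + reg d μ ∈ strClass d D μ G,
      expectedError A (g.law f) ((f : Vec d → ℝ) + reg d μ)

end HeavyTailLB

namespace HeavyTailLB

/-! For a linear `f` with slope `s`, completing the square gives `F x - F⋆ = ‖μ • x + s‖² / (2μ)`,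
so optimizing `F` amounts to estimating `s`. The hard slopes are `r • w`, where `w` has entries `±M`
on `m = ⌊σl² / σs²⌋` coordinates. The oracle ignores the query and returns `w ⊙ z`, with `z` a
random mask whose relevant coordinates have mean `r` and are nonzero with probability at most `r`.
For `r = 1 / (2T)` a coordinate stays hidden through all `T` rounds with probability at least one
half, and then its sign cannot be guessed. Averaging over signs, each coordinate costs at least `(r
M)² / 2`, so the error is at least `m (r M)² / (4μ)` (`exists_sign_lintegral_ge`,
`le_minimaxErrorStr_of_isMask`).

It remains to see how large the moment bounds let `M` be. If `m r ≤ 1`, at most one coordinate is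
shown at a time, and both bounds follow from `(2M)^p m r ≤ (√m σs)^p` (`isMask_singleCoordMask`). If
`m r > 1`, the coordinates are independent Bernoulli variables, and a variance computation allows `r
M² ≤ σs²` (`isMask_bernoulliMask`). Either way `m (r M)²` can reach order `σs² (m / T)^(2 - 2/p)`,
which is the claimed rate by `rate_le`; `M` is lowered when `G` or `D` is the tighter constraint.

An oracle must also answer every other convex Lipschitz function, measurably in the query. There it
returns a noiseless subgradient, selected measurably by a countable form of the Hahn–Banach argument
(`exists_measurable_subgradient`). -/

/-! ### Sublinear functions and measurable linear minorants. -/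

/-- Subadditive and positively homogeneous real functions. -/
structure IsSublinear {E : Type*} [AddCommGroup E] [Module ℝ E] (q : E → ℝ) : Prop where
  add_le : ∀ u v, q (u + v) ≤ q u + q v
  smul_eq : ∀ t : ℝ, 0 < t → ∀ v, q (t • v) = t * q v

/-- The directional derivative at `e` of a sublinear function `q`. -/
noncomputable def linearizeAt {E : Type*} [AddCommGroup E] [Module ℝ E] (q : E → ℝ) (e v : E) : ℝ :=
  ⨅ n : ℕ, (q ((n : ℝ) • e + v) - n * q e)

/-- The one-sided directional derivative of a convex function. -/
noncomputable def dirDeriv {E : Type*} [AddCommGroup E] [Module ℝ E] (f : E → ℝ) (x v : E) : ℝ :=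
  ⨅ n : ℕ, ((n + 1 : ℝ) * (f (x + (n + 1 : ℝ)⁻¹ • v) - f x))

theorem isSublinear_of_le {E : Type*} [AddCommGroup E] [Module ℝ E] {q : E → ℝ}
    (hadd : ∀ u v, q (u + v) ≤ q u + q v)
    (hsmul : ∀ t : ℝ, 0 < t → ∀ v, q (t • v) ≤ t * q v) : IsSublinear q := by
  refine ⟨hadd, fun t ht v => le_antisymm (hsmul t ht v) ?_⟩
  have h := hsmul t⁻¹ (inv_pos.2 ht) (t • v)
  rw [smul_smul, inv_mul_cancel₀ ht.ne', one_smul] at h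
  calc t * q v ≤ t * (t⁻¹ * q (t • v)) := by gcongr
    _ = q (t • v) := by field_simp

namespace IsSublinear

variable {E : Type*} [AddCommGroup E] [Module ℝ E] {q : E → ℝ}

theorem map_zero (hq : IsSublinear q) : q 0 = 0 := by
  have := hq.smul_eq 2 (by norm_num) 0
  rw [smul_zero] at this
  linarith

theorem smul_eq_of_nonneg (hq : IsSublinear q) {t : ℝ} (ht : 0 ≤ t) (v : E) :
    q (t • v) = t * q v := by
  rcases ht.eq_or_lt with rfl | h
  · simp [hq.map_zero]
  · exact hq.smul_eq t h v

theorem neg_le (hq : IsSublinear q) (v : E) : -q (-v) ≤ q v := by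
  have := hq.add_le v (-v)
  rw [add_neg_cancel, hq.map_zero] at this
  linarith

theorem linearizeAt_bddBelow (hq : IsSublinear q) (e v : E) :
    BddBelow (Set.range fun n : ℕ => q ((n : ℝ) • e + v) - n * q e) := by
  refine ⟨-q (-v), ?_⟩
  rintro _ ⟨n, rfl⟩
  have := hq.add_le ((n : ℝ) • e + v) (-v)
  rw [add_neg_cancel_right, hq.smul_eq_of_nonneg n.cast_nonneg] at this
  simp only
  linarith

theorem linearizeAt_le_apply (hq : IsSublinear q) (e v : E) (n : ℕ) :
    linearizeAt q e v ≤ q ((n : ℝ) • e + v) - n * q e :=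
  ciInf_le (hq.linearizeAt_bddBelow e v) n

theorem linearizeAt_le (hq : IsSublinear q) (e v : E) : linearizeAt q e v ≤ q v := by
  simpa using hq.linearizeAt_le_apply e v 0

theorem linearizeAt_isSublinear (hq : IsSublinear q) (e : E) : IsSublinear (linearizeAt q e) := by
  refine isSublinear_of_le (fun u v => ?_) fun t ht v => ?_
  · refine le_ciInf_add_ciInf fun n k => ?_
    have h1 := hq.linearizeAt_le_apply e (u + v) (n + k)
    have h2 := hq.add_le ((n : ℝ) • e + u) ((k : ℝ) • e + v)
    have h3 : ((n : ℝ) • e + u) + ((k : ℝ) • e + v) = ((n + k : ℕ) : ℝ) • e + (u + v) := by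
      push_cast
      module
    rw [h3] at h2
    push_cast at *
    linarith
  · unfold linearizeAt
    rw [Real.mul_iInf_of_nonneg ht.le]
    refine le_ciInf fun n => ?_
    -- The infimum runs over integers only, so `t * n` is rounded up; the surplus multiple of `e`
    -- costs exactly what the term `n * q e` gives back.
    have h1 := hq.linearizeAt_le_apply e (t • v) ⌈t * n⌉₊
    have h2 := hq.add_le (t • ((n : ℝ) • e + v)) (((⌈t * n⌉₊ : ℝ) - t * n) • e)
    have h3 : t • ((n : ℝ) • e + v) + ((⌈t * n⌉₊ : ℝ) - t * n) • e
        = (⌈t * n⌉₊ : ℝ) • e + t • v := by module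
    rw [h3, hq.smul_eq t ht, hq.smul_eq_of_nonneg (sub_nonneg.2 (Nat.le_ceil _))] at h2
    unfold linearizeAt at h1
    linarith

/-- The term `n = 1` of the infimum at `-e` is `-q e`, which is what makes the new function linear
along `e`. -/
theorem linearizeAt_neg (hq : IsSublinear q) (e : E) : linearizeAt q e (-e) = -linearizeAt q e e := by
  have h0 := (hq.linearizeAt_isSublinear e).neg_le e
  have h1 := hq.linearizeAt_le e e
  have h2 := hq.linearizeAt_le_apply e (-e) 1
  simp only [Nat.cast_one, one_smul, add_neg_cancel, hq.map_zero] at h2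
  linarith

/-- Linearity along a line passes to any smaller sublinear function, so directions already treated
are not spoiled later. -/
theorem linearizeAt_neg_of_neg (hq : IsSublinear q) (e : E) {u : E} (hu : q (-u) = -q u) :
    linearizeAt q e (-u) = -linearizeAt q e u := by
  have h0 := (hq.linearizeAt_isSublinear e).neg_le u
  have h1 := hq.linearizeAt_le e u
  have h2 := hq.linearizeAt_le e (-u)
  linarith

theorem smul_eq_of_neg (hq : IsSublinear q) {u : E} (hu : q (-u) = -q u) (t : ℝ) :
    q (t • u) = t * q u := by
  rcases le_total 0 t with h | h
  · exact hq.smul_eq_of_nonneg h u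
  · have := hq.smul_eq_of_nonneg (neg_nonneg.2 h) (-u)
    rw [smul_neg, neg_smul, neg_neg, hu] at this
    rw [this]
    ring

theorem sum_le (hq : IsSublinear q) {ι : Type*} (s : Finset ι) (v : ι → E) :
    q (∑ i ∈ s, v i) ≤ ∑ i ∈ s, q (v i) :=
  Finset.le_sum_of_subadditive q hq.map_zero.le hq.add_le s v

end IsSublinear

/-- A measurable family of sublinear functions on `ℝ^d` dominates a measurable family of linear
functionals. -/
theorem exists_measurable_inner_le {X : Type*} [MeasurableSpace X] {d : ℕ} (q : X → Vec d → ℝ)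
    (hq : ∀ x, IsSublinear (q x)) (hm : ∀ v, Measurable fun x => q x v) :
    ∃ L : X → Vec d, Measurable L ∧ ∀ x v, inner ℝ (L x) v ≤ q x v := by
  let b : Fin d → Vec d := fun i => EuclideanSpace.single i 1
  -- Linearize along the basis vectors one after the other. Each stage is a countable infimum, so
  -- measurability in `x` survives.
  have key : ∀ s : Finset (Fin d), ∃ q' : X → Vec d → ℝ, (∀ x, IsSublinear (q' x)) ∧
      (∀ v, Measurable fun x => q' x v) ∧ (∀ x v, q' x v ≤ q x v) ∧
      ∀ i ∈ s, ∀ x, q' x (-b i) = -q' x (b i) := by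
    intro s
    induction s using Finset.induction_on with
    | empty => exact ⟨q, hq, hm, fun _ _ => le_rfl, by simp⟩
    | insert a s _ ih =>
      obtain ⟨q', h1, h2, h3, h4⟩ := ih
      refine ⟨fun x => linearizeAt (q' x) (b a), fun x => (h1 x).linearizeAt_isSublinear _,
        fun v => ?_, fun x v => ((h1 x).linearizeAt_le _ v).trans (h3 x v), fun i hi x => ?_⟩
      · exact Measurable.iInf fun n => (h2 _).sub ((h2 _).const_mul _)
      · rcases Finset.mem_insert.1 hi with rfl | hi
        · exact (h1 x).linearizeAt_neg _
        · exact (h1 x).linearizeAt_neg_of_neg _ (h4 i hi x)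
  obtain ⟨q', h1, h2, h3, h4⟩ := key Finset.univ
  refine ⟨fun x => WithLp.toLp 2 fun i => q' x (b i), ?_, fun x v => ?_⟩
  · exact (WithLp.measurable_toLp 2 _).comp (measurable_pi_lambda _ fun i => h2 _)
  · have hle : ∀ w : Vec d, q' x w ≤ ∑ i, w i * q' x (b i) := by
      intro w
      have hw : w = ∑ i, w i • b i := by
        have := (EuclideanSpace.basisFun (Fin d) ℝ).sum_repr w
        simpa [b] using this.symm
      calc q' x w = q' x (∑ i, w i • b i) := by rw [← hw]
        _ ≤ ∑ i, q' x (w i • b i) := (h1 x).sum_le _ _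
        _ = _ := Finset.sum_congr rfl fun i _ =>
          (h1 x).smul_eq_of_neg (h4 i (Finset.mem_univ i) x) _
    -- The upper bound at `-v` is a lower bound at `v`, since `-q' x (-v) ≤ q' x v`.
    have h5 := hle (-v)
    have h6 := (h1 x).neg_le v
    have h7 : inner ℝ (WithLp.toLp 2 fun i => q' x (b i) : Vec d) v = ∑ i, v i * q' x (b i) := by
      simp [PiLp.inner_apply]
    simp only [PiLp.neg_apply, neg_mul, Finset.sum_neg_distrib] at h5
    rw [h7]
    linarith [h3 x v]

/-! ### Directional derivatives of convex functions and subgradient selection. -/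

section dirDeriv

variable {E : Type*} [NormedAddCommGroup E] [NormedSpace ℝ E] {f : E → ℝ} {K : ℝ}

theorem slope_mono_of_convexOn (hf : ConvexOn ℝ Set.univ f) (x v : E) {s t : ℝ} (hs : 0 < s)
    (hst : s ≤ t) : s⁻¹ * (f (x + s • v) - f x) ≤ t⁻¹ * (f (x + t • v) - f x) := by
  have ht : 0 < t := hs.trans_le hst
  have h := hf.2 (Set.mem_univ x) (Set.mem_univ (x + t • v))
    (sub_nonneg.2 ((div_le_one ht).2 hst)) (div_nonneg hs.le ht.le) (sub_add_cancel 1 (s / t))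
  have hx : (1 - s / t) • x + (s / t) • (x + t • v) = x + s • v := by
    rw [smul_add, smul_smul, div_mul_cancel₀ _ ht.ne']
    module
  rw [hx, smul_eq_mul, smul_eq_mul] at h
  have h2 : f (x + s • v) - f x ≤ s / t * (f (x + t • v) - f x) := by linarith
  calc s⁻¹ * (f (x + s • v) - f x) ≤ s⁻¹ * (s / t * (f (x + t • v) - f x)) := by gcongr
    _ = _ := by field_simp

theorem dirDeriv_bddBelow (hK : ∀ x y, |f x - f y| ≤ K * ‖x - y‖) (x v : E) :
    BddBelow (Set.range fun n : ℕ => (n + 1 : ℝ) * (f (x + (n + 1 : ℝ)⁻¹ • v) - f x)) := by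
  refine ⟨-(K * ‖v‖), ?_⟩
  rintro _ ⟨n, rfl⟩
  have hn : (0 : ℝ) < n + 1 := by positivity
  have h := (abs_le.1 (hK (x + (n + 1 : ℝ)⁻¹ • v) x)).1
  rw [add_sub_cancel_left, norm_smul, Real.norm_of_nonneg (by positivity)] at h
  calc -(K * ‖v‖) = (n + 1 : ℝ) * -(K * ((n + 1 : ℝ)⁻¹ * ‖v‖)) := by field_simp
    _ ≤ _ := mul_le_mul_of_nonneg_left h hn.le

theorem dirDeriv_le_slope (hf : ConvexOn ℝ Set.univ f) (hK : ∀ x y, |f x - f y| ≤ K * ‖x - y‖)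
    (x v : E) {t : ℝ} (ht : 0 < t) : dirDeriv f x v ≤ t⁻¹ * (f (x + t • v) - f x) := by
  have h := slope_mono_of_convexOn hf x v (s := ((⌈t⁻¹⌉₊ : ℝ) + 1)⁻¹) (t := t) (by positivity)
    (by
      rw [inv_le_comm₀ (by positivity) ht]
      linarith [Nat.le_ceil t⁻¹])
  rw [inv_inv] at h
  exact (ciInf_le (dirDeriv_bddBelow hK x v) ⌈t⁻¹⌉₊).trans h

theorem dirDeriv_isSublinear (hf : ConvexOn ℝ Set.univ f)
    (hK : ∀ x y, |f x - f y| ≤ K * ‖x - y‖) (x : E) : IsSublinear (dirDeriv f x) := by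
  refine isSublinear_of_le (fun u v => ?_) fun t ht v => ?_
  · refine le_ciInf_add_ciInf fun n k => ?_
    have hn : (0 : ℝ) < (n + 1 : ℝ)⁻¹ := by positivity
    have hk : (0 : ℝ) < (k + 1 : ℝ)⁻¹ := by positivity
    -- Slopes decrease with the step, so both can be compared at a common step `r`; midpoint
    -- convexity then bounds the slope along `u + v` at step `r / 2`.
    obtain ⟨r, hr, hrn, hrk⟩ : ∃ r : ℝ, 0 < r ∧ r ≤ (n + 1 : ℝ)⁻¹ ∧ r ≤ (k + 1 : ℝ)⁻¹ :=
      ⟨_, lt_min hn hk, min_le_left _ _, min_le_right _ _⟩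
    have h1 := dirDeriv_le_slope hf hK x (u + v) (half_pos hr)
    have h2 := slope_mono_of_convexOn hf x u hr hrn
    have h3 := slope_mono_of_convexOn hf x v hr hrk
    have h4 := hf.2 (Set.mem_univ (x + r • u)) (Set.mem_univ (x + r • v))
      one_half_pos.le one_half_pos.le (add_halves (1 : ℝ))
    have h5 : (1 / 2 : ℝ) • (x + r • u) + (1 / 2 : ℝ) • (x + r • v)
        = x + (r / 2) • (u + v) := by module
    rw [h5, smul_eq_mul, smul_eq_mul] at h4
    rw [inv_inv] at h2 h3
    have h6 : (r / 2)⁻¹ * (f (x + (r / 2) • (u + v)) - f x)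
        ≤ (r / 2)⁻¹ * (1 / 2 * (f (x + r • u) - f x) + 1 / 2 * (f (x + r • v) - f x)) := by
      gcongr
      linarith
    have h7 : (r / 2)⁻¹ * (1 / 2 * (f (x + r • u) - f x) + 1 / 2 * (f (x + r • v) - f x))
        = r⁻¹ * (f (x + r • u) - f x) + r⁻¹ * (f (x + r • v) - f x) := by field_simp
    linarith
  · unfold dirDeriv
    rw [Real.mul_iInf_of_nonneg ht.le]
    refine le_ciInf fun n => ?_
    have h := dirDeriv_le_slope hf hK x (t • v) (t := (t * (n + 1 : ℝ))⁻¹) (by positivity)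
    have e : (t * (n + 1 : ℝ))⁻¹ • t • v = (n + 1 : ℝ)⁻¹ • v := by
      rw [smul_smul]
      congr 1
      field_simp
    rw [e, inv_inv, mul_assoc] at h
    exact h

end dirDeriv

/-- Convex Lipschitz functions on `ℝ^d` have measurable subgradient selections. -/
theorem exists_measurable_subgradient {d : ℕ} {G : ℝ} {f : Vec d → ℝ} (hf : f ∈ cvxLipClass d G) :
    ∃ s : Vec d → Vec d, Measurable s ∧ ∀ x, s x ∈ subdifferential f x := by
  obtain ⟨hc, hL⟩ := hf
  have hcont : Continuous f := by
    refine (LipschitzWith.of_dist_le' (K := G) fun x y => ?_).continuous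
    rw [Real.dist_eq, dist_eq_norm]
    exact hL x y
  obtain ⟨L, hL1, hL2⟩ := exists_measurable_inner_le (dirDeriv f) (dirDeriv_isSublinear hc hL)
    fun v => Measurable.iInf fun n => Continuous.measurable (by fun_prop)
  refine ⟨L, hL1, fun x y => ?_⟩
  have h1 := hL2 x (y - x)
  have h2 := dirDeriv_le_slope hc hL x (y - x) one_pos
  rw [inv_one, one_mul, one_smul, add_sub_cancel] at h2
  linarith

/-! ### Masks and the oracles built from them. -/

/-- The coordinatewise product with a fixed vector, as a continuous linear map. -/
noncomputable def hadamard {d : ℕ} (w : Vec d) : Vec d →L[ℝ] Vec d :=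
  LinearMap.toContinuousLinearMap
    { toFun := fun z => WithLp.toLp 2 fun i => w i * z i
      map_add' := fun x y => by ext i; simp [mul_add]
      map_smul' := fun c x => by ext i; simp; ring }

@[simp]
theorem hadamard_apply {d : ℕ} (w z : Vec d) (i : Fin d) : hadamard w z i = w i * z i := rfl

/-- The vectors supported on `I` with coordinates of absolute value at most `M`. -/
def boxVec {d : ℕ} (I : Finset (Fin d)) (M : ℝ) : Set (Vec d) :=
  {w | (∀ i ∈ I, |w i| ≤ M) ∧ ∀ i ∉ I, w i = 0}

/-- A random vector `z` each of whose coordinates in `I` has mean `r` and is nonzero with probability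
at most `r`, such that `w ⊙ z` obeys the moment bounds of an oracle for all `w` in the box of
radius `M`. -/
structure IsMask {d : ℕ} (ν : Measure (Vec d)) (I : Finset (Fin d)) (r M p σs σl : ℝ) : Prop where
  integrable : Integrable (fun z => z) ν
  mean : ∀ i ∈ I, ∫ z, z i ∂ν = r
  ne_zero_le : ∀ i ∈ I, ν {z | z i ≠ 0} ≤ ENNReal.ofReal r
  dir_moment_le : ∀ w ∈ boxVec I M, ∀ e : Vec d, ‖e‖ = 1 →
    ∫⁻ z, ENNReal.ofReal (|inner ℝ e (hadamard w z - r • w)| ^ p) ∂ν ≤ ENNReal.ofReal (σs ^ p)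
  norm_moment_le : ∀ w ∈ boxVec I M,
    ∫⁻ z, ENNReal.ofReal (‖hadamard w z - r • w‖ ^ p) ∂ν ≤ ENNReal.ofReal (σl ^ p)

section Oracle

variable {d : ℕ} {ν : Measure (Vec d)} {I : Finset (Fin d)} {r M p σs σl G : ℝ}

theorem IsMask.integral_hadamard (h : IsMask ν I r M p σs σl) {w : Vec d} (hw : ∀ i ∉ I, w i = 0) :
    ∫ z, hadamard w z ∂ν = r • w := by
  rw [ContinuousLinearMap.integral_comp_comm _ h.integrable]
  ext i
  rw [hadamard_apply, PiLp.smul_apply, smul_eq_mul]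
  by_cases hi : i ∈ I
  · have := ContinuousLinearMap.integral_comp_comm (EuclideanSpace.proj (𝕜 := ℝ) i) h.integrable
    rw [show (∫ z, z ∂ν) i = r from this.symm.trans (h.mean i hi), mul_comm]
  · simp [hw i hi]

/-- A function with slope `r • w` receives the masked answer at every query; any other function
receives a measurable subgradient without noise. As `r ≠ 0`, the function determines `w`, so the
choice is consistent. -/
theorem exists_oracle_law [IsProbabilityMeasure ν] (h : IsMask ν I r M p σs σl) (hr : 0 < r)
    (hp : 0 < p) (f : cvxLipClass d G) :
    ∃ κ : Kernel (Vec d) (Vec d), IsMarkovKernel κ ∧ (∀ x, Integrable (fun g => g) (κ x)) ∧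
      (∀ x, (∫ g, g ∂(κ x)) ∈ subdifferential f.1 x) ∧
      (∀ x (e : Vec d), ‖e‖ = 1 → ∫⁻ g, ENNReal.ofReal (|inner ℝ e (g - ∫ g', g' ∂(κ x))| ^ p) ∂(κ x)
        ≤ ENNReal.ofReal (σs ^ p)) ∧
      (∀ x, ∫⁻ g, ENNReal.ofReal (‖g - ∫ g', g' ∂(κ x)‖ ^ p) ∂(κ x) ≤ ENNReal.ofReal (σl ^ p)) ∧
      ∀ w ∈ boxVec I M, (f : Vec d → ℝ) = (fun x => inner ℝ (r • w) x) →
        κ = Kernel.const _ (ν.map (hadamard w)) := by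
  by_cases hf : ∃ w ∈ boxVec I M, (f : Vec d → ℝ) = fun x => inner ℝ (r • w) x
  · obtain ⟨w, hw, hfw⟩ := hf
    have hmeas : Measurable (hadamard w) := (hadamard w).continuous.measurable
    have hmean : ∫ g, g ∂(ν.map (hadamard w)) = r • w := by
      rw [integral_map hmeas.aemeasurable (f := fun g => g) aestronglyMeasurable_id]
      exact h.integral_hadamard hw.2
    have : IsProbabilityMeasure (ν.map (hadamard w)) :=
      Measure.isProbabilityMeasure_map hmeas.aemeasurable
    refine ⟨Kernel.const _ (ν.map (hadamard w)), inferInstance, fun x => ?_, fun x y => ?_,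
      fun x e he => ?_, fun x => ?_, fun w' hw' hfw' => ?_⟩
    · rw [Kernel.const_apply, integrable_map_measure (g := fun g => g) aestronglyMeasurable_id hmeas.aemeasurable]
      exact (hadamard w).integrable_comp h.integrable
    · rw [Kernel.const_apply, hmean, hfw]
      simp only
      rw [← inner_add_right, add_sub_cancel]
    · rw [Kernel.const_apply, hmean, lintegral_map (by fun_prop) hmeas]
      exact h.dir_moment_le w hw e he
    · rw [Kernel.const_apply, hmean, lintegral_map (by fun_prop) hmeas]
      exact h.norm_moment_le w hw
    · have : r • w = r • w' := ext_inner_right ℝ fun v => congrFun (hfw.symm.trans hfw') v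
      rw [smul_right_injective _ hr.ne' this]
  · obtain ⟨s, hs, hsf⟩ := exists_measurable_subgradient f.2
    refine ⟨Kernel.deterministic s hs, inferInstance, fun x => ?_, fun x => ?_, fun x e he => ?_,
      fun x => ?_, fun w hw hfw => (hf ⟨w, hw, hfw⟩).elim⟩
    · rw [Kernel.deterministic_apply]
      exact integrable_dirac (by simp)
    · rw [Kernel.deterministic_apply, integral_dirac]
      exact hsf x
    · rw [Kernel.deterministic_apply, integral_dirac, lintegral_dirac]
      simp [Real.zero_rpow hp.ne']
    · rw [Kernel.deterministic_apply, integral_dirac, lintegral_dirac]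
      simp [Real.zero_rpow hp.ne']

theorem exists_oracle [IsProbabilityMeasure ν] (h : IsMask ν I r M p σs σl) (hr : 0 < r)
    (hp : 0 < p) :
    ∃ g : Oracle d G p σs σl, ∀ (f : cvxLipClass d G), ∀ w ∈ boxVec I M,
      (f : Vec d → ℝ) = (fun x => inner ℝ (r • w) x) →
        g.law f = Kernel.const _ (ν.map (hadamard w)) := by
  choose κ h1 h2 h3 h4 h5 h6 using exists_oracle_law (G := G) h hr hp
  exact ⟨⟨κ, h1, h2, h3, h4, h5⟩, h6⟩

end Oracle

/-! ### Transcripts for oracles that ignore the query. -/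

section Transcript

variable {d T : ℕ} (A : Algorithm d T)

theorem transcript_isProbabilityMeasure (κ : Kernel (Vec d) (Vec d)) [IsMarkovKernel κ] :
    ∀ (t : ℕ) (ht : t ≤ T), IsProbabilityMeasure (transcript A κ t ht)
  | 0, _ => by
    unfold transcript
    infer_instance
  | t + 1, ht => by
    unfold transcript
    have := transcript_isProbabilityMeasure κ t (Nat.le_of_succ_le ht)
    have : IsMarkovKernel (κ.comap (A.next t (Nat.le_of_succ_le ht)) (A.measurable_next t _)) :=
      inferInstance
    exact Measure.isProbabilityMeasure_map (measurable_snoc d t).aemeasurable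

theorem transcript_const_succ (ν : Measure (Vec d)) [IsProbabilityMeasure ν] (t : ℕ)
    (ht : t + 1 ≤ T) :
    transcript A (Kernel.const _ ν) (t + 1) ht =
      ((transcript A (Kernel.const _ ν) t (Nat.le_of_succ_le ht)).prod ν).map
        (fun z => (Fin.snoc (α := fun _ => Vec d) z.1 z.2 : Fin (t + 1) → Vec d)) := by
  have := transcript_isProbabilityMeasure A (Kernel.const _ ν) t (Nat.le_of_succ_le ht)
  rw [transcript, ← Measure.compProd_const]
  rfl

/-- This couples all sign vectors: their transcripts are images of one transcript of masks, whose
law does not involve the signs. -/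
theorem transcript_const_map (ν : Measure (Vec d)) [IsProbabilityMeasure ν] {ψ : Vec d → Vec d}
    (hψ : Measurable ψ) (t : ℕ) (ht : t ≤ T) :
    transcript A (Kernel.const _ (ν.map ψ)) t ht =
      (transcript A (Kernel.const _ ν) t ht).map fun h j => ψ (h j) := by
  have hpm : IsProbabilityMeasure (ν.map ψ) := Measure.isProbabilityMeasure_map hψ.aemeasurable
  have hΨ : ∀ t, Measurable fun (h : Fin t → Vec d) j => ψ (h j) := fun t =>
    measurable_pi_lambda _ fun j => hψ.comp (measurable_pi_apply j)
  induction t with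
  | zero =>
    unfold transcript
    rw [Measure.map_dirac' (hΨ 0)]
    congr 1
    exact Subsingleton.elim _ _
  | succ t ih =>
    have := transcript_isProbabilityMeasure A (Kernel.const _ ν) t (Nat.le_of_succ_le ht)
    rw [transcript_const_succ, transcript_const_succ, ih, Measure.map_prod_map _ _ (hΨ t) hψ,
      Measure.map_map (measurable_snoc d t) ((hΨ t).prodMap hψ),
      Measure.map_map (hΨ (t + 1)) (measurable_snoc d t)]
    congr 1
    funext z
    funext j
    refine Fin.lastCases ?_ (fun i => ?_) j <;> simp

/-- The union bound over the rounds. -/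
theorem transcript_const_exists_le (ν : Measure (Vec d)) [IsProbabilityMeasure ν] {B : Set (Vec d)}
    (hB : MeasurableSet B) (t : ℕ) (ht : t ≤ T) :
    transcript A (Kernel.const _ ν) t ht {h | ∃ j, h j ∈ B} ≤ t * ν B := by
  have hm : ∀ t, MeasurableSet {h : Fin t → Vec d | ∃ j, h j ∈ B} := fun t => by
    rw [Set.ofPred_exists]
    exact MeasurableSet.iUnion fun j => measurable_pi_apply j hB
  induction t with
  | zero => simp
  | succ t ih =>
    have := transcript_isProbabilityMeasure A (Kernel.const _ ν) t (Nat.le_of_succ_le ht)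
    rw [transcript_const_succ, Measure.map_apply (measurable_snoc d t) (hm _)]
    have hsub : (fun z : (Fin t → Vec d) × Vec d =>
        (Fin.snoc (α := fun _ => Vec d) z.1 z.2 : Fin (t + 1) → Vec d)) ⁻¹' {h | ∃ j, h j ∈ B}
        ⊆ ({h | ∃ j, h j ∈ B} ×ˢ Set.univ) ∪ (Set.univ ×ˢ B) := by
      rintro ⟨h, z⟩ ⟨j, hj⟩
      revert hj
      refine Fin.lastCases (fun hj => ?_) (fun i hj => ?_) j
      · right
        simpa using hj
      · left
        simp only [Fin.snoc_castSucc] at hj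
        exact ⟨⟨i, hj⟩, trivial⟩
    refine (measure_mono hsub).trans ((measure_union_le _ _).trans ?_)
    rw [Measure.prod_prod, Measure.prod_prod, measure_univ, measure_univ, mul_one, one_mul]
    push_cast
    rw [add_mul, one_mul]
    gcongr
    exact ih _

end Transcript

/-! ### Averaging over hidden signs. -/

section Average

variable {d T : ℕ}

/-- The vector with coordinates `ε i * M` on `I` and zero elsewhere. -/
noncomputable def signVec (I : Finset (Fin d)) (M : ℝ) (ε : Fin d → ℤˣ) : Vec d :=
  WithLp.toLp 2 fun i => if i ∈ I then ((ε i : ℤ) : ℝ) * M else 0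

theorem abs_units_cast (u : ℤˣ) : |((u : ℤ) : ℝ)| = 1 := by
  rcases Int.units_eq_one_or u with rfl | rfl <;> simp

theorem signVec_mem_boxVec (I : Finset (Fin d)) {M : ℝ} (hM : 0 ≤ M) (ε : Fin d → ℤˣ) :
    signVec I M ε ∈ boxVec I M := by
  refine ⟨fun i hi => ?_, fun i hi => by simp [signVec, hi]⟩
  simp [signVec, hi, abs_mul, abs_units_cast, abs_of_nonneg hM]

theorem norm_signVec_sq (I : Finset (Fin d)) (M : ℝ) (ε : Fin d → ℤˣ) :
    ‖signVec I M ε‖ ^ 2 = I.card * M ^ 2 := by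
  rw [EuclideanSpace.real_norm_sq_eq]
  have : ∀ i, (signVec I M ε i) ^ 2 = if i ∈ I then M ^ 2 else 0 := fun i => by
    by_cases hi : i ∈ I
    · rw [if_pos hi, ← sq_abs, signVec]
      simp [hi, abs_mul, abs_units_cast]
    · simp [signVec, hi]
  simp [this]

/-- If every coordinate in `I` is unobserved with probability at least one half, then every
estimator of the sign vector has error of order `|I| (r M)²` for some choice of signs. -/
theorem exists_sign_lintegral_ge (N : Measure (Fin T → Vec d)) [IsProbabilityMeasure N]
    (I : Finset (Fin d)) (r M : ℝ) (hN : ∀ i ∈ I, N {h | ∃ j, h j ∈ {z : Vec d | z i ≠ 0}} ≤ 2⁻¹)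
    {a : (Fin T → Vec d) → Vec d} (ha : Measurable a) :
    ∃ ε : Fin d → ℤˣ, ENNReal.ofReal (I.card * (r * M) ^ 2 / 2) ≤
      ∫⁻ h, ENNReal.ofReal (‖a (fun j => hadamard (signVec I M ε) (h j))
        + r • signVec I M ε‖ ^ 2) ∂N := by
  let Ψ : (Fin d → ℤˣ) → (Fin T → Vec d) → (Fin T → Vec d) :=
    fun ε h j => hadamard (signVec I M ε) (h j)
  have hΨ : ∀ ε, Measurable (Ψ ε) := fun ε => measurable_pi_lambda _ fun j =>
    (hadamard _).continuous.measurable.comp (measurable_pi_apply j)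
  let φ : Fin d → (Fin d → ℤˣ) → ℝ≥0∞ := fun i ε =>
    ∫⁻ h, ENNReal.ofReal ((a (Ψ ε h) i + r * signVec I M ε i) ^ 2) ∂N
  have hφm : ∀ i ε, Measurable fun h => ENNReal.ofReal ((a (Ψ ε h) i + r * signVec I M ε i) ^ 2) := by
    intro i ε
    have : Measurable fun h => a (Ψ ε h) i :=
      (EuclideanSpace.proj (𝕜 := ℝ) i).continuous.measurable.comp (ha.comp (hΨ ε))
    fun_prop
  -- Two-point argument: flip the sign at `i` alone. While coordinate `i` is hidden the estimator
  -- sees the same data, and `(a + b)² + (a - b)² ≥ 2 b²`; the hidden event has probability at least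
  -- one half.
  have hpair : ∀ i ∈ I, ∀ ε, ENNReal.ofReal ((r * M) ^ 2) ≤ φ i ε + φ i (ε * Pi.mulSingle i (-1)) := by
    intro i hi ε
    set ε' := ε * Pi.mulSingle i (-1) with hε'
    have hne : ∀ k, k ≠ i → signVec I M ε' k = signVec I M ε k := fun k hk => by
      simp [signVec, hε', Pi.mulSingle_eq_of_ne hk]
    have heq : signVec I M ε' i = -signVec I M ε i := by
      simp [signVec, hε', hi]
    have hsq : (signVec I M ε i) ^ 2 = M ^ 2 := by
      rw [← sq_abs, signVec]
      simp [hi, abs_mul, abs_units_cast]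
    let C : Set (Fin T → Vec d) := {h | ∃ j, h j ∈ {z : Vec d | z i ≠ 0}}
    have hC : MeasurableSet C := by
      have : MeasurableSet {z : Vec d | z i ≠ 0} :=
        ((EuclideanSpace.proj (𝕜 := ℝ) i).continuous.measurable (measurableSet_singleton 0)).compl
      change MeasurableSet {h | _}
      rw [Set.ofPred_exists]
      exact MeasurableSet.iUnion fun j => measurable_pi_apply j this
    have hCc : (2⁻¹ : ℝ≥0∞) ≤ N Cᶜ := by
      rw [prob_compl_eq_one_sub hC, ← ENNReal.one_sub_inv_two]
      exact tsub_le_tsub_left (hN i hi) 1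
    calc ENNReal.ofReal ((r * M) ^ 2) = ENNReal.ofReal (2 * (r * M) ^ 2) * 2⁻¹ := by
          rw [ENNReal.ofReal_mul two_pos.le, ENNReal.ofReal_ofNat, mul_right_comm,
            ENNReal.mul_inv_cancel two_ne_zero ENNReal.ofNat_ne_top, one_mul]
      _ ≤ ENNReal.ofReal (2 * (r * M) ^ 2) * N Cᶜ := by gcongr
      _ = ∫⁻ _ in Cᶜ, ENNReal.ofReal (2 * (r * M) ^ 2) ∂N := by rw [setLIntegral_const]
      _ ≤ ∫⁻ h in Cᶜ, (ENNReal.ofReal ((a (Ψ ε h) i + r * signVec I M ε i) ^ 2)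
            + ENNReal.ofReal ((a (Ψ ε' h) i + r * signVec I M ε' i) ^ 2)) ∂N := by
          refine setLIntegral_mono' hC.compl fun h hh => ?_
          have hz : ∀ j, h j i = 0 := fun j => by
            by_contra hj
            exact hh ⟨j, hj⟩
          have hobs : Ψ ε' h = Ψ ε h := by
            funext j
            ext k
            simp only [Ψ, hadamard_apply]
            by_cases hk : k = i
            · rw [hk, hz j, mul_zero, mul_zero]
            · rw [hne k hk]
          rw [hobs, heq, ← ENNReal.ofReal_add (sq_nonneg _) (sq_nonneg _)]
          refine ENNReal.ofReal_le_ofReal ?_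
          rw [mul_pow, ← hsq]
          nlinarith [sq_nonneg (a (Ψ ε h) i)]
      _ ≤ ∫⁻ h, (ENNReal.ofReal ((a (Ψ ε h) i + r * signVec I M ε i) ^ 2)
            + ENNReal.ofReal ((a (Ψ ε' h) i + r * signVec I M ε' i) ^ 2)) ∂N :=
          setLIntegral_le_lintegral _ _
      _ = φ i ε + φ i ε' := lintegral_add_left (hφm i ε) _
  -- Flipping one sign permutes the sign vectors, so both terms of the pair have the same total.
  have hsum : ∀ i ∈ I, ∑ _ε : Fin d → ℤˣ, ENNReal.ofReal ((r * M) ^ 2) ≤ 2 * ∑ ε, φ i ε := by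
    intro i hi
    refine (Finset.sum_le_sum fun ε _ => hpair i hi ε).trans_eq ?_
    rw [Finset.sum_add_distrib, two_mul]
    congr 1
    exact Equiv.sum_comp (Equiv.mulRight (Pi.mulSingle i (-1) : Fin d → ℤˣ)) (φ i)
  have hφ : ∃ ε, ENNReal.ofReal (I.card * (r * M) ^ 2) ≤ 2 * ∑ i ∈ I, φ i ε := by
    by_contra! hcon
    have h1 := ENNReal.sum_lt_sum_of_nonempty (s := (Finset.univ : Finset (Fin d → ℤˣ)))
      Finset.univ_nonempty fun ε _ => hcon ε
    refine absurd h1 (not_lt.2 ?_)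
    rw [← Finset.mul_sum, Finset.sum_comm, Finset.mul_sum]
    refine le_trans ?_ (Finset.sum_le_sum hsum)
    rw [Finset.sum_comm]
    refine Finset.sum_le_sum fun ε _ => ?_
    rw [Finset.sum_const, nsmul_eq_mul, ENNReal.ofReal_mul (Nat.cast_nonneg _), ENNReal.ofReal_natCast]
  obtain ⟨ε, hε⟩ := hφ
  refine ⟨ε, ?_⟩
  have h2 : ENNReal.ofReal (I.card * (r * M) ^ 2 / 2) ≤ ∑ i ∈ I, φ i ε := by
    rw [ENNReal.ofReal_div_of_pos two_pos, ENNReal.ofReal_ofNat]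
    exact ENNReal.div_le_of_le_mul' hε
  refine h2.trans ?_
  rw [← lintegral_finsetSum _ fun i _ => hφm i ε]
  refine lintegral_mono fun h => ?_
  rw [← ENNReal.ofReal_sum_of_nonneg fun i _ => sq_nonneg _, EuclideanSpace.real_norm_sq_eq]
  refine ENNReal.ofReal_le_ofReal ?_
  refine Finset.sum_le_sum_of_subset_of_nonneg (Finset.subset_univ I) fun i _ _ => sq_nonneg _

end Average

/-! ### Regularized linear functions and reduction to estimation. -/

theorem linear_mem_cvxLipClass {d : ℕ} {G : ℝ} {s : Vec d} (hs : ‖s‖ ≤ G) :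
    (fun x => inner ℝ s x) ∈ cvxLipClass d G := by
  refine ⟨(innerₛₗ ℝ s).convexOn convex_univ, fun x y => ?_⟩
  rw [← inner_sub_right]
  exact (abs_real_inner_le_norm _ _).trans (by gcongr)

theorem linear_add_reg_eq {d : ℕ} {μ : ℝ} (hμ : 0 < μ) (s x : Vec d) :
    ((fun x => inner ℝ s x) + reg d μ : Vec d → ℝ) x
      = (2 * μ)⁻¹ * ‖μ • x + s‖ ^ 2 - (2 * μ)⁻¹ * ‖s‖ ^ 2 := by
  rw [Pi.add_apply, reg, norm_add_sq_real, norm_smul, Real.norm_of_nonneg hμ.le, inner_smul_left,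
    real_inner_comm]
  simp
  field_simp
  ring

theorem linear_add_reg_mem_strClass {d : ℕ} {D μ G : ℝ} (hμ : 0 < μ) {s : Vec d} (hs : ‖s‖ ≤ G)
    (hsD : ‖s‖ ≤ μ * D) : ((fun x => inner ℝ s x) + reg d μ : Vec d → ℝ) ∈ strClass d D μ G := by
  refine ⟨⟨_, linear_mem_cvxLipClass hs, rfl⟩, ?_⟩
  have hmem : -(μ⁻¹ • s) ∈ argmin ((fun x => inner ℝ s x) + reg d μ : Vec d → ℝ) := by
    intro y
    rw [linear_add_reg_eq hμ, linear_add_reg_eq hμ, smul_neg, smul_smul, mul_inv_cancel₀ hμ.ne',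
      one_smul, neg_add_cancel, norm_zero]
    have : 0 ≤ (2 * μ)⁻¹ * ‖μ • y + s‖ ^ 2 := by positivity
    linarith
  refine (iInf₂_le _ hmem).trans (ENNReal.ofReal_le_ofReal ?_)
  rw [norm_neg, norm_smul, norm_inv, Real.norm_of_nonneg hμ.le, inv_mul_le_iff₀ hμ]
  exact hsD

theorem le_linear_add_reg_sub_iInf {d : ℕ} {μ : ℝ} (hμ : 0 < μ) (s x : Vec d) :
    (2 * μ)⁻¹ * ‖μ • x + s‖ ^ 2 ≤ ((fun x => inner ℝ s x) + reg d μ : Vec d → ℝ) x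
      - ⨅ y, ((fun x => inner ℝ s x) + reg d μ : Vec d → ℝ) y := by
  have hb : BddBelow (Set.range ((fun x => inner ℝ s x) + reg d μ : Vec d → ℝ)) := by
    refine ⟨-((2 * μ)⁻¹ * ‖s‖ ^ 2), ?_⟩
    rintro _ ⟨y, rfl⟩
    rw [linear_add_reg_eq hμ]
    have : 0 ≤ (2 * μ)⁻¹ * ‖μ • y + s‖ ^ 2 := by positivity
    linarith
  have h := ciInf_le hb (-(μ⁻¹ • s))
  rw [linear_add_reg_eq hμ, smul_neg, smul_smul, mul_inv_cancel₀ hμ.ne',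
    one_smul, neg_add_cancel, norm_zero] at h
  rw [linear_add_reg_eq hμ]
  linarith

/-- The minimax error is bounded below by the error of estimating the mean of a masked sign
vector. -/
theorem le_minimaxErrorStr_of_isMask {d T : ℕ} {D μ G p σs σl r M : ℝ} {ν : Measure (Vec d)}
    [IsProbabilityMeasure ν] {I : Finset (Fin d)} (h : IsMask ν I r M p σs σl) (hμ : 0 < μ)
    (hp : 0 < p) (hr : 0 < r) (hM : 0 ≤ M) (hTr : T * r ≤ 1 / 2)
    (hG : 0 ≤ G) (hD : 0 ≤ D) (hMG : I.card * (r * M) ^ 2 ≤ G ^ 2)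
    (hMD : I.card * (r * M) ^ 2 ≤ (μ * D) ^ 2) :
    ENNReal.ofReal (I.card * (r * M) ^ 2 / (4 * μ)) ≤ minimaxErrorStr d T D μ G p σs σl := by
  obtain ⟨g, hg⟩ := exists_oracle (G := G) h hr hp
  refine le_iSup_of_le g (le_iInf fun A => ?_)
  have hpm := transcript_isProbabilityMeasure A (Kernel.const _ ν) T le_rfl
  obtain ⟨ε, hε⟩ := exists_sign_lintegral_ge (transcript A (Kernel.const _ ν) T le_rfl) I r M
    (fun i hi => by
      have hB : MeasurableSet {z : Vec d | z i ≠ 0} :=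
        ((EuclideanSpace.proj (𝕜 := ℝ) i).continuous.measurable (measurableSet_singleton 0)).compl
      refine (transcript_const_exists_le A ν hB T le_rfl).trans ?_
      calc (T : ℝ≥0∞) * ν {z : Vec d | z i ≠ 0} ≤ T * ENNReal.ofReal r := by
            gcongr
            exact h.ne_zero_le i hi
        _ = ENNReal.ofReal (T * r) := by
            rw [ENNReal.ofReal_mul (Nat.cast_nonneg _), ENNReal.ofReal_natCast]
        _ ≤ ENNReal.ofReal (1 / 2) := ENNReal.ofReal_le_ofReal hTr
        _ = 2⁻¹ := by
            rw [one_div, ENNReal.ofReal_inv_of_pos two_pos, ENNReal.ofReal_ofNat])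
    -- The minimizer is `-μ⁻¹ • s`, so the last iterate scaled by `μ` is an estimator of `-s`.
    (a := fun h => μ • A.next T le_rfl h) ((A.measurable_next T le_rfl).const_smul μ)
  set w := signVec I M ε with hw
  have hwb : w ∈ boxVec I M := signVec_mem_boxVec I hM ε
  have hnorm : ‖r • w‖ ^ 2 = I.card * (r * M) ^ 2 := by
    rw [norm_smul, mul_pow, hw, norm_signVec_sq, Real.norm_eq_abs, sq_abs]
    ring
  have hsG : ‖r • w‖ ≤ G := (sq_le_sq₀ (norm_nonneg _) hG).1 (hnorm ▸ hMG)
  have hsD : ‖r • w‖ ≤ μ * D := (sq_le_sq₀ (norm_nonneg _) (by positivity)).1 (hnorm ▸ hMD)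
  refine le_iSup_of_le ⟨_, linear_mem_cvxLipClass hsG⟩
    (le_iSup_of_le (linear_add_reg_mem_strClass hμ hsG hsD) ?_)
  rw [hg _ w hwb rfl, expectedError, transcript_const_map A ν (hadamard w).continuous.measurable,
    lintegral_map]
  · calc ENNReal.ofReal (I.card * (r * M) ^ 2 / (4 * μ))
        = ENNReal.ofReal ((2 * μ)⁻¹) * ENNReal.ofReal (I.card * (r * M) ^ 2 / 2) := by
          rw [← ENNReal.ofReal_mul (by positivity)]
          congr 1
          field_simp
          norm_num
      _ ≤ _ := mul_le_mul_right hε _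
      _ = _ := (lintegral_const_mul' _ _ ENNReal.ofReal_ne_top).symm
      _ ≤ _ := by
          refine lintegral_mono fun h => ?_
          rw [← ENNReal.ofReal_mul (by positivity)]
          exact ENNReal.ofReal_le_ofReal (le_linear_add_reg_sub_iInf hμ _ _)
  · have := A.measurable_next T le_rfl
    have hc : Continuous ((fun x => inner ℝ (r • w) x) + reg d μ : Vec d → ℝ) := by
      unfold reg
      fun_prop
    exact ((hc.measurable.comp this).sub_const _).ennreal_ofReal
  · exact measurable_pi_lambda _ fun j =>
      (hadamard _).continuous.measurable.comp (measurable_pi_apply j)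

/-! ### The mask showing at most one coordinate. -/

section SingleCoordinate

variable {d : ℕ}

/-- With probability `r` for each `i ∈ I` the standard basis vector `e_i`, and zero otherwise. -/
noncomputable def singleCoordMask (I : Finset (Fin d)) (r : ℝ) : Measure (Vec d) :=
  ∑ i ∈ I, ENNReal.ofReal r • Measure.dirac (EuclideanSpace.single i 1)
    + ENNReal.ofReal (1 - I.card * r) • Measure.dirac 0

theorem lintegral_singleCoordMask (I : Finset (Fin d)) (r : ℝ) (f : Vec d → ℝ≥0∞) :
    ∫⁻ z, f z ∂(singleCoordMask I r) = ∑ i ∈ I, ENNReal.ofReal r * f (EuclideanSpace.single i 1)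
      + ENNReal.ofReal (1 - I.card * r) * f 0 := by
  simp [singleCoordMask, lintegral_add_measure, lintegral_finsetSum_measure]

variable {I : Finset (Fin d)} {r : ℝ}

theorem singleCoordMask_isProbabilityMeasure (hr : 0 ≤ r) (hI : I.card * r ≤ 1) :
    IsProbabilityMeasure (singleCoordMask I r) := by
  refine ⟨?_⟩
  rw [← lintegral_one, lintegral_singleCoordMask]
  simp only [mul_one, Finset.sum_const, nsmul_eq_mul]
  rw [← ENNReal.ofReal_natCast, ← ENNReal.ofReal_mul (Nat.cast_nonneg _),
    ← ENNReal.ofReal_add (by positivity) (by linarith)]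
  simp

theorem integrable_singleCoordMask {E : Type*} [NormedAddCommGroup E] (f : Vec d → E) :
    Integrable f (singleCoordMask I r) := by
  have hd : ∀ z : Vec d, Integrable f (Measure.dirac z) := fun z => integrable_dirac (by simp)
  refine Integrable.add_measure ?_ ((hd 0).smul_measure ENNReal.ofReal_ne_top)
  exact integrable_finsetSum_measure.2 fun i _ => (hd _).smul_measure ENNReal.ofReal_ne_top

theorem integral_singleCoordMask (hr : 0 ≤ r) {i : Fin d} (hi : i ∈ I) :
    ∫ z, z i ∂(singleCoordMask I r) = r := by
  have hf := integrable_singleCoordMask (I := I) (r := r) fun z : Vec d => z i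
  rw [singleCoordMask, integrable_add_measure] at hf
  rw [singleCoordMask, integral_add_measure hf.1 hf.2,
    integral_finsetSum_measure (integrable_finsetSum_measure.1 hf.1)]
  simp [hi, hr]

theorem add_rpow_le_two_rpow {a b p : ℝ} (ha : 0 ≤ a) (hb : 0 ≤ b) (hp : 1 ≤ p) :
    (a + b) ^ p ≤ 2 ^ (p - 1) * (a ^ p + b ^ p) := by
  lift a to NNReal using ha
  lift b to NNReal using hb
  exact_mod_cast NNReal.rpow_add_le_mul_rpow_add_rpow a b hp

/-- The `p`-th absolute moment of a centered variable is at most `2 ^ p` times that of the variable,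
for a variable with values `y i` with probability `r` each and zero otherwise. -/
theorem sum_mul_add_rpow_le (I : Finset (Fin d)) {r p : ℝ} (hr : 0 ≤ r) (hI : I.card * r ≤ 1)
    (hp : 1 ≤ p) {y : Fin d → ℝ} (hy : ∀ i, 0 ≤ y i) :
    ∑ i ∈ I, r * (y i + ∑ j ∈ I, r * y j) ^ p + (1 - I.card * r) * (∑ j ∈ I, r * y j) ^ p
      ≤ 2 ^ p * (r * ∑ i ∈ I, y i ^ p) := by
  set R := ∑ j ∈ I, r * y j with hR
  have hR0 : 0 ≤ R := Finset.sum_nonneg fun j _ => mul_nonneg hr (hy j)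
  -- Jensen's inequality, with the leftover weight `1 - I.card * r` placed at `0`.
  have hJ : R ^ p ≤ r * ∑ i ∈ I, y i ^ p := by
    have := (convexOn_rpow hp).map_add_sum_le (t := I) (w := fun _ => r) (p := y)
      (v := 1 - I.card * r) (q := 0) (fun _ _ => hr) (by simp) (fun i _ => hy i) (by linarith)
      (by simp)
    simp only [smul_eq_mul, mul_zero, zero_add] at this
    rw [Real.zero_rpow (by linarith), mul_zero, zero_add, ← Finset.mul_sum I (fun i => y i ^ p)] at this
    exact this
  have h2 : (1 : ℝ) ≤ 2 ^ (p - 1) := Real.one_le_rpow (by norm_num) (by linarith)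
  have hRp : 0 ≤ R ^ p := Real.rpow_nonneg hR0 p
  have h1 : ∑ i ∈ I, r * (y i + R) ^ p ≤ ∑ i ∈ I, r * (2 ^ (p - 1) * (y i ^ p + R ^ p)) := by
    gcongr with i
    exact add_rpow_le_two_rpow (hy i) hR0 hp
  have h3 : ∑ i ∈ I, r * ((2 : ℝ) ^ (p - 1) * (y i ^ p + R ^ p))
      = 2 ^ (p - 1) * (r * ∑ i ∈ I, y i ^ p) + 2 ^ (p - 1) * (I.card * r * R ^ p) := by
    simp only [mul_add, Finset.sum_add_distrib, Finset.sum_const, nsmul_eq_mul, Finset.mul_sum]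
    congr 1
    · exact Finset.sum_congr rfl fun i _ => by ring
    · ring
  have h4 : (1 - I.card * r) * R ^ p ≤ 2 ^ (p - 1) * ((1 - I.card * r) * R ^ p) :=
    le_mul_of_one_le_left (mul_nonneg (by linarith) hRp) h2
  have h5 : (2 : ℝ) ^ p = 2 ^ (p - 1) * 2 := by
    rw [← Real.rpow_add_one (by norm_num), sub_add_cancel]
  have h6 : (2 : ℝ) ^ (p - 1) * R ^ p ≤ 2 ^ (p - 1) * (r * ∑ i ∈ I, y i ^ p) := by gcongr
  rw [h5]
  linarith

theorem lintegral_rpow_singleCoordMask_le {p : ℝ} (hr : 0 ≤ r) (hI : I.card * r ≤ 1)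
    (hp : 1 ≤ p) {y : Fin d → ℝ} (hy : ∀ i, 0 ≤ y i) {Φ : Vec d → ℝ} (hΦ : ∀ z, 0 ≤ Φ z)
    (h0 : Φ 0 ≤ ∑ j ∈ I, r * y j)
    (h1 : ∀ i ∈ I, Φ (EuclideanSpace.single i 1) ≤ y i + ∑ j ∈ I, r * y j) :
    ∫⁻ z, ENNReal.ofReal (Φ z ^ p) ∂(singleCoordMask I r)
      ≤ ENNReal.ofReal (2 ^ p * (r * ∑ i ∈ I, y i ^ p)) := by
  have hR0 : 0 ≤ ∑ j ∈ I, r * y j := Finset.sum_nonneg fun j _ => mul_nonneg hr (hy j)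
  rw [lintegral_singleCoordMask]
  refine le_trans ?_ (ENNReal.ofReal_le_ofReal (sum_mul_add_rpow_le I hr hI hp hy))
  have hn : ∀ i ∈ I, 0 ≤ r * (y i + ∑ j ∈ I, r * y j) ^ p := fun i _ =>
    mul_nonneg hr (Real.rpow_nonneg (add_nonneg (hy i) hR0) p)
  rw [ENNReal.ofReal_add (Finset.sum_nonneg hn)
    (mul_nonneg (by linarith) (Real.rpow_nonneg hR0 p)), ENNReal.ofReal_sum_of_nonneg hn,
    ENNReal.ofReal_mul (by linarith : 0 ≤ 1 - I.card * r)]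
  gcongr with i hi
  · rw [ENNReal.ofReal_mul hr]
    gcongr
    · exact hΦ _
    · exact h1 i hi
  · exact hΦ _

/-- The power mean inequality for unit vectors. -/
theorem sum_abs_rpow_le {p : ℝ} (hp : 0 < p) (hp2 : p ≤ 2) (I : Finset (Fin d)) {e : Vec d}
    (he : ‖e‖ = 1) : ∑ i ∈ I, |e i| ^ p ≤ (I.card : ℝ) ^ (1 - p / 2) := by
  have hS : 0 ≤ ∑ i ∈ I, |e i| ^ p := Finset.sum_nonneg fun i _ => by positivity
  have h := Real.rpow_sum_le_const_mul_sum_rpow I (fun i => |e i| ^ p) (p := 2 / p)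
    ((one_le_div hp).2 hp2)
  have h1 : ∀ i, |(|e i| ^ p)| = |e i| ^ p := fun i => abs_of_nonneg (by positivity)
  have h2 : ∀ i, (|e i| ^ p) ^ (2 / p) = e i ^ 2 := fun i => by
    rw [← Real.rpow_mul (abs_nonneg _), mul_div_cancel₀ _ hp.ne', Real.rpow_two, sq_abs]
  simp only [h1, h2] at h
  have h3 : ∑ i ∈ I, e i ^ 2 ≤ 1 := by
    calc ∑ i ∈ I, e i ^ 2 ≤ ∑ i, e i ^ 2 :=
          Finset.sum_le_sum_of_subset_of_nonneg (Finset.subset_univ I) fun i _ _ => sq_nonneg _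
      _ = 1 := by rw [← EuclideanSpace.real_norm_sq_eq, he, one_pow]
  have h4 : (∑ i ∈ I, |e i| ^ p) ^ (2 / p) ≤ (I.card : ℝ) ^ (2 / p - 1) :=
    h.trans (mul_le_of_le_one_right (by positivity) h3)
  have h5 := Real.rpow_le_rpow (by positivity) h4 (by positivity : 0 ≤ p / 2)
  rw [← Real.rpow_mul hS, ← Real.rpow_mul (Nat.cast_nonneg _)] at h5
  have e1 : 2 / p * (p / 2) = 1 := by field_simp
  have e2 : (2 / p - 1) * (p / 2) = 1 - p / 2 := by field_simp
  rwa [e1, e2, Real.rpow_one] at h5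

/-- Since at most one coordinate is nonzero, `p`-th moments are sums over coordinates. In a unit
direction `∑ |e i|^p ≤ m^(1 - p/2)`, against `m` for the norm; this gain of `(√m)^p` matches the
ratio of the two bounds, so one condition on `M` serves both. -/
theorem isMask_singleCoordMask {M p σs σl : ℝ} (hr : 0 ≤ r) (hI : I.card * r ≤ 1)
    (hI0 : 0 < I.card) (hp : 1 ≤ p) (hp2 : p ≤ 2) (hM : 0 ≤ M) (hσs : 0 ≤ σs)
    (hσ : √I.card * σs ≤ σl) (h : (2 * M) ^ p * (I.card * r) ≤ (√I.card * σs) ^ p) :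
    IsMask (singleCoordMask I r) I r M p σs σl := by
  have hp0 : 0 < p := by linarith
  have hc : (0 : ℝ) < I.card := by exact_mod_cast hI0
  refine ⟨integrable_singleCoordMask _, fun i hi => integral_singleCoordMask hr hi, fun i hi => ?_,
    fun w hw e he => ?_, fun w hw => ?_⟩
  · have hB : MeasurableSet {z : Vec d | z i ≠ 0} :=
      ((EuclideanSpace.proj (𝕜 := ℝ) i).continuous.measurable (measurableSet_singleton 0)).compl
    rw [← lintegral_indicator_one hB, lintegral_singleCoordMask]
    simp [Set.indicator_apply, hi]
  · have hinner : |inner ℝ e (r • w)| ≤ ∑ j ∈ I, r * (|e j| * M) := by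
      rw [inner_smul_right, abs_mul, abs_of_nonneg hr, ← Finset.mul_sum, PiLp.inner_apply]
      gcongr
      refine (Finset.abs_sum_le_sum_abs _ _).trans ?_
      rw [← Finset.sum_subset (Finset.subset_univ I) fun i _ hi => by simp [hw.2 i hi]]
      refine Finset.sum_le_sum fun i hi => ?_
      rw [show inner ℝ (e i) (w i) = e i * w i by simp [mul_comm], abs_mul]
      gcongr
      exact hw.1 i hi
    refine (lintegral_rpow_singleCoordMask_le hr hI hp (y := fun i => |e i| * M)
      (fun i => by positivity) (fun z => abs_nonneg _) ?_ fun i hi => ?_).trans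
        (ENNReal.ofReal_le_ofReal ?_)
    · rw [map_zero, zero_sub, inner_neg_right, abs_neg]
      exact hinner
    · rw [inner_sub_right]
      refine (abs_sub _ _).trans (add_le_add ?_ hinner)
      have : inner ℝ e (hadamard w (EuclideanSpace.single i 1)) = e i * w i := by
        simp [PiLp.inner_apply, mul_comm]
      rw [this, abs_mul]
      gcongr
      exact hw.1 i hi
    · simp only [Real.mul_rpow (abs_nonneg _) hM, ← Finset.sum_mul]
      have h1 := sum_abs_rpow_le hp0 hp2 I he
      have h2 : (I.card : ℝ) ^ (1 - p / 2) = I.card * ((√I.card) ^ p)⁻¹ := by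
        rw [Real.rpow_sub hc, Real.rpow_one, Real.sqrt_eq_rpow, ← Real.rpow_mul hc.le,
          div_eq_mul_inv]
        congr 3
        ring
      have h3 : 0 < (√I.card) ^ p := by positivity
      calc 2 ^ p * (r * ((∑ i ∈ I, |e i| ^ p) * M ^ p))
          ≤ 2 ^ p * (r * (I.card * ((√I.card) ^ p)⁻¹ * M ^ p)) := by
            rw [← h2]
            gcongr
        _ = ((2 * M) ^ p * (I.card * r)) * ((√I.card) ^ p)⁻¹ := by
            rw [Real.mul_rpow two_pos.le hM]
            ring
        _ ≤ (√I.card * σs) ^ p * ((√I.card) ^ p)⁻¹ := by gcongr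
        _ = σs ^ p := by
            rw [Real.mul_rpow (by positivity) hσs]
            field_simp
  · have hnorm : ‖r • w‖ ≤ ∑ j ∈ I, r * M := by
      rw [norm_smul, Real.norm_of_nonneg hr, ← Finset.mul_sum]
      gcongr
      have hw' : w = ∑ j ∈ I, w j • EuclideanSpace.single j (1 : ℝ) := by
        rw [Finset.sum_subset (Finset.subset_univ I) fun i _ hi => by simp [hw.2 i hi]]
        simpa using ((EuclideanSpace.basisFun (Fin d) ℝ).sum_repr w).symm
      rw [hw']
      refine (norm_sum_le _ _).trans (Finset.sum_le_sum fun j hj => ?_)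
      rw [norm_smul]
      simpa using hw.1 j hj
    refine (lintegral_rpow_singleCoordMask_le hr hI hp (y := fun _ => M)
      (fun i => hM) (fun z => norm_nonneg _) ?_ fun i hi => ?_).trans
        (ENNReal.ofReal_le_ofReal ?_)
    · rw [map_zero, zero_sub, norm_neg]
      exact hnorm
    · refine (norm_sub_le _ _).trans (add_le_add ?_ hnorm)
      have : hadamard w (EuclideanSpace.single i 1) = EuclideanSpace.single i (w i) := by
        ext j
        by_cases hj : j = i
        · subst hj
          simp
        · simp [hj]
      rw [this]
      simpa using hw.1 i hi
    · rw [Finset.sum_const, nsmul_eq_mul]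
      calc 2 ^ p * (r * (I.card * M ^ p)) = (2 * M) ^ p * (I.card * r) := by
            rw [Real.mul_rpow two_pos.le hM]
            ring
        _ ≤ (√I.card * σs) ^ p := h
        _ ≤ σl ^ p := by gcongr

end SingleCoordinate

/-! ### The mask with independent coordinates. -/

section Bernoulli

/-- The Bernoulli law on `{0, 1} ⊆ ℝ`. -/
noncomputable def bernoulliReal (r : ℝ) : Measure ℝ :=
  ENNReal.ofReal r • Measure.dirac 1 + ENNReal.ofReal (1 - r) • Measure.dirac 0

variable {r : ℝ}

theorem bernoulliReal_isProbabilityMeasure (hr : 0 ≤ r) (hr1 : r ≤ 1) :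
    IsProbabilityMeasure (bernoulliReal r) := by
  refine ⟨?_⟩
  simp only [bernoulliReal, Measure.add_apply, Measure.smul_apply, measure_univ, smul_eq_mul, mul_one]
  rw [← ENNReal.ofReal_add hr (by linarith)]
  simp

theorem integrable_bernoulliReal (f : ℝ → ℝ) : Integrable f (bernoulliReal r) :=
  ((integrable_dirac (by simp)).smul_measure ENNReal.ofReal_ne_top).add_measure
    ((integrable_dirac (by simp)).smul_measure ENNReal.ofReal_ne_top)

theorem integral_bernoulliReal (hr : 0 ≤ r) (hr1 : r ≤ 1) (f : ℝ → ℝ) :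
    ∫ t, f t ∂(bernoulliReal r) = r * f 1 + (1 - r) * f 0 := by
  have hf := integrable_bernoulliReal (r := r) f
  rw [bernoulliReal, integrable_add_measure] at hf
  rw [bernoulliReal, integral_add_measure hf.1 hf.2]
  simp [hr, hr1]

variable {d : ℕ}

theorem lintegral_sq_pi_bernoulliReal_le (hr : 0 ≤ r) (hr1 : r ≤ 1) (c : Fin d → ℝ) :
    ∫⁻ z : Fin d → ℝ, ENNReal.ofReal ((∑ i, c i * (z i - r)) ^ 2)
        ∂(Measure.pi fun _ => bernoulliReal r)
      ≤ ENNReal.ofReal (r * ∑ i, c i ^ 2) := by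
  have := bernoulliReal_isProbabilityMeasure hr hr1
  have hL : ∀ i, MemLp (fun t => c i * t) 2 (bernoulliReal r) := fun i =>
    (memLp_two_iff_integrable_sq (by fun_prop)).2 (integrable_bernoulliReal _)
  have hv := variance_sum_pi (μ := fun _ : Fin d => bernoulliReal r) hL
  set X : (Fin d → ℝ) → ℝ := ∑ i, fun z : Fin d → ℝ => c i * z i with hX
  have hXa : ∀ z, X z = ∑ i, c i * z i := fun z => by simp [hX]
  have hint : ∀ i, Integrable (fun z : Fin d → ℝ => c i * z i)
      (Measure.pi fun _ => bernoulliReal r) := fun i =>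
    integrable_comp_eval (μ := fun _ => bernoulliReal r) (i := i) (f := fun t => c i * t)
      (integrable_bernoulliReal _)
  have hXm : ∫ z, X z ∂(Measure.pi fun _ => bernoulliReal r) = ∑ i, c i * r := by
    simp only [hXa]
    rw [integral_finsetSum _ fun i _ => hint i]
    refine Finset.sum_congr rfl fun i _ => ?_
    rw [integral_comp_eval (μ := fun _ => bernoulliReal r) (i := i) (f := fun t => c i * t)
      (by fun_prop), integral_bernoulliReal hr hr1]
    ring
  have hXL : MemLp X 2 (Measure.pi fun _ => bernoulliReal r) :=
    memLp_finsetSum' _ fun i _ => (hL i).comp_measurePreserving (measurePreserving_eval _ i)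
  have hvar : ∀ i, Var[fun t => c i * t; bernoulliReal r] ≤ r * c i ^ 2 := fun i => by
    refine (variance_le_expectation_sq (by fun_prop)).trans_eq ?_
    rw [integral_bernoulliReal hr hr1]
    simp
  calc _ = evariance X (Measure.pi fun _ => bernoulliReal r) := by
        rw [evariance_eq_lintegral_ofReal, hXm]
        refine lintegral_congr fun z => ?_
        simp only [hXa, mul_sub, Finset.sum_sub_distrib]
    _ = ENNReal.ofReal Var[X; Measure.pi fun _ => bernoulliReal r] := (ofReal_variance hXL).symm
    _ ≤ _ := by
        refine ENNReal.ofReal_le_ofReal ?_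
        rw [hv, Finset.mul_sum]
        exact Finset.sum_le_sum fun i _ => hvar i

/-- Moments of order `p ≤ 2` are controlled by the second moment. -/
theorem lintegral_rpow_le_of_lintegral_sq_le {Ω : Type*} [MeasurableSpace Ω] {P : Measure Ω}
    [IsProbabilityMeasure P] {X : Ω → ℝ} (hX : Measurable X) (hX0 : ∀ ω, 0 ≤ X ω) {p s : ℝ}
    (hp : 0 < p) (hp2 : p ≤ 2) (hs : 0 ≤ s)
    (h : ∫⁻ ω, ENNReal.ofReal (X ω ^ 2) ∂P ≤ ENNReal.ofReal (s ^ 2)) :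
    ∫⁻ ω, ENNReal.ofReal (X ω ^ p) ∂P ≤ ENNReal.ofReal (s ^ p) := by
  have key := eLpNorm'_le_eLpNorm'_of_exponent_le hp hp2 P hX.aestronglyMeasurable
  rw [eLpNorm'_eq_lintegral_enorm, eLpNorm'_eq_lintegral_enorm] at key
  have e : ∀ q : ℝ, 0 ≤ q → ∀ ω, ‖X ω‖ₑ ^ q = ENNReal.ofReal (X ω ^ q) := fun q hq ω => by
    rw [Real.enorm_of_nonneg (hX0 ω), ENNReal.ofReal_rpow_of_nonneg (hX0 ω) hq]
  simp only [e p hp.le, e 2 two_pos.le, Real.rpow_two] at key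
  have h2 : (∫⁻ ω, ENNReal.ofReal (X ω ^ 2) ∂P) ^ (1 / 2 : ℝ) ≤ ENNReal.ofReal s := by
    refine (ENNReal.rpow_le_rpow h (by norm_num)).trans_eq ?_
    rw [ENNReal.ofReal_rpow_of_nonneg (sq_nonneg s) (by norm_num), ← Real.sqrt_eq_rpow,
      Real.sqrt_sq hs]
  have h3 := ENNReal.rpow_le_rpow (key.trans h2) hp.le
  rwa [← ENNReal.rpow_mul, one_div_mul_cancel hp.ne', ENNReal.rpow_one,
    ENNReal.ofReal_rpow_of_nonneg hs hp.le] at h3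

/-- Independent Bernoulli coordinates. -/
noncomputable def bernoulliMask (d : ℕ) (r : ℝ) : Measure (Vec d) :=
  (Measure.pi fun _ => bernoulliReal r).map (WithLp.toLp 2)

theorem bernoulliMask_isProbabilityMeasure (hr : 0 ≤ r) (hr1 : r ≤ 1) :
    IsProbabilityMeasure (bernoulliMask d r) := by
  have := bernoulliReal_isProbabilityMeasure hr hr1
  exact Measure.isProbabilityMeasure_map (WithLp.measurable_toLp 2 _).aemeasurable

theorem lintegral_sq_inner_bernoulliMask_le (hr : 0 ≤ r) (hr1 : r ≤ 1) {I : Finset (Fin d)} {M : ℝ}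
    {w : Vec d} (hw : w ∈ boxVec I M) {e : Vec d} (he : ‖e‖ = 1) :
    ∫⁻ z, ENNReal.ofReal ((inner ℝ e (hadamard w z - r • w)) ^ 2) ∂(bernoulliMask d r)
      ≤ ENNReal.ofReal (r * M ^ 2) := by
  rw [bernoulliMask, lintegral_map (by fun_prop) (WithLp.measurable_toLp 2 _)]
  have h := lintegral_sq_pi_bernoulliReal_le hr hr1 fun i => e i * w i
  have hin : ∀ z : Fin d → ℝ, inner ℝ e (hadamard w (WithLp.toLp 2 z) - r • w)
      = ∑ i, e i * w i * (z i - r) := fun z => by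
    rw [PiLp.inner_apply]
    refine Finset.sum_congr rfl fun i _ => ?_
    simp
    ring
  simp only [hin]
  refine h.trans (ENNReal.ofReal_le_ofReal ?_)
  gcongr
  calc ∑ i, (e i * w i) ^ 2 ≤ ∑ i, e i ^ 2 * M ^ 2 := by
        refine Finset.sum_le_sum fun i _ => ?_
        rw [mul_pow]
        gcongr ?_ * ?_
        by_cases hi : i ∈ I
        · rw [← sq_abs]
          gcongr
          exact hw.1 i hi
        · rw [hw.2 i hi, zero_pow two_ne_zero]
          exact sq_nonneg M
    _ = M ^ 2 := by
        rw [← Finset.sum_mul, ← EuclideanSpace.real_norm_sq_eq, he, one_pow, one_mul]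

/-- By independence the variance in every unit direction is at most `r * M ^ 2`; summing over the
coordinate directions in `I` bounds the norm. Monotonicity of `L^p` norms on a probability space
passes from exponent `2` to `p`. -/
theorem isMask_bernoulliMask {I : Finset (Fin d)} {M p σs σl : ℝ} (hr : 0 ≤ r) (hr1 : r ≤ 1)
    (hp : 0 < p) (hp2 : p ≤ 2) (hσs : 0 ≤ σs) (hσ : √I.card * σs ≤ σl)
    (h : r * M ^ 2 ≤ σs ^ 2) : IsMask (bernoulliMask d r) I r M p σs σl := by
  have hβ := bernoulliReal_isProbabilityMeasure hr hr1
  have hprob := bernoulliMask_isProbabilityMeasure (d := d) hr hr1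
  have hto := WithLp.measurable_toLp 2 (Fin d → ℝ)
  have hproj : ∀ i, Measurable fun z : Vec d => z i := fun i =>
    (EuclideanSpace.proj (𝕜 := ℝ) i).continuous.measurable
  refine ⟨?_, fun i hi => ?_, fun i hi => ?_, fun w hw e he => ?_, fun w hw => ?_⟩
  · refine Integrable.of_eval_piLp fun i => ?_
    rw [bernoulliMask, integrable_map_measure (hproj i).aestronglyMeasurable hto.aemeasurable]
    exact integrable_comp_eval (μ := fun _ => bernoulliReal r) (i := i) (f := fun t => t)
      (integrable_bernoulliReal _)
  · rw [bernoulliMask, integral_map hto.aemeasurable (hproj i).aestronglyMeasurable]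
    change ∫ z : Fin d → ℝ, z i ∂_ = r
    rw [integral_comp_eval (μ := fun _ => bernoulliReal r) (i := i) (f := fun t => t)
      aestronglyMeasurable_id, integral_bernoulliReal hr hr1]
    simp
  · have hB : MeasurableSet {z : Vec d | z i ≠ 0} := ((hproj i) (measurableSet_singleton 0)).compl
    rw [bernoulliMask, Measure.map_apply hto hB]
    have := (measurePreserving_eval (fun _ : Fin d => bernoulliReal r) i).measure_preimage
      (s := {0}ᶜ) (measurableSet_singleton 0).compl.nullMeasurableSet
    refine (this.trans ?_).le
    simp [bernoulliReal]
  · refine lintegral_rpow_le_of_lintegral_sq_le (by fun_prop) (fun z => abs_nonneg _) hp hp2 hσs ?_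
    simp only [sq_abs]
    exact (lintegral_sq_inner_bernoulliMask_le hr hr1 hw he).trans (ENNReal.ofReal_le_ofReal h)
  · refine lintegral_rpow_le_of_lintegral_sq_le (by fun_prop) (fun z => norm_nonneg _) hp hp2
      ((by positivity : 0 ≤ √I.card * σs).trans hσ) ?_
    have hcoord : ∀ z : Vec d, ENNReal.ofReal (‖hadamard w z - r • w‖ ^ 2) = ∑ i ∈ I,
        ENNReal.ofReal ((inner ℝ (EuclideanSpace.single i 1) (hadamard w z - r • w)) ^ 2) := by
      intro z
      rw [← ENNReal.ofReal_sum_of_nonneg fun i _ => sq_nonneg _, EuclideanSpace.real_norm_sq_eq,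
        Finset.sum_subset (Finset.subset_univ I)]
      · simp [EuclideanSpace.inner_single_left]
      · intro i _ hi
        simp [EuclideanSpace.inner_single_left, hw.2 i hi]
    simp only [hcoord]
    rw [lintegral_finsetSum _ fun i _ => by fun_prop]
    calc _ ≤ ∑ i ∈ I, ENNReal.ofReal (r * M ^ 2) := Finset.sum_le_sum fun i _ =>
          lintegral_sq_inner_bernoulliMask_le hr hr1 hw (by simp)
      _ = ENNReal.ofReal (I.card * (r * M ^ 2)) := by
          rw [Finset.sum_const, nsmul_eq_mul, ENNReal.ofReal_mul (Nat.cast_nonneg _),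
            ENNReal.ofReal_natCast]
      _ ≤ ENNReal.ofReal (σl ^ 2) := by
          refine ENNReal.ofReal_le_ofReal ?_
          calc (I.card : ℝ) * (r * M ^ 2) ≤ I.card * σs ^ 2 := by gcongr
            _ = (√I.card * σs) ^ 2 := by rw [mul_pow, Real.sq_sqrt (Nat.cast_nonneg _)]
            _ ≤ σl ^ 2 := by gcongr

end Bernoulli

/-! ### Choice of parameters and the final rate. -/

/-- Optimizing the signal strength in `le_minimaxErrorStr_of_isMask`. -/
theorem le_minimaxErrorStr_of_forall_isMask {d T : ℕ} {D μ G p σs σl r M₀ : ℝ} {ν : Measure (Vec d)}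
    [IsProbabilityMeasure ν] {I : Finset (Fin d)} (hI : 0 < I.card)
    (h : ∀ M, 0 ≤ M → M ≤ M₀ → IsMask ν I r M p σs σl) (hμ : 0 < μ)
    (hp : 0 < p) (hr : 0 < r) (hM₀ : 0 ≤ M₀) (hTr : T * r ≤ 1 / 2) (hG : 0 ≤ G) (hD : 0 ≤ D) :
    ENNReal.ofReal (min ((μ * D) ^ 2) (min (G ^ 2) (I.card * (r * M₀) ^ 2)) / (4 * μ))
      ≤ minimaxErrorStr d T D μ G p σs σl := by
  have hc : (0 : ℝ) < I.card := by exact_mod_cast hI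
  set B := min ((μ * D) ^ 2) (min (G ^ 2) (I.card * (r * M₀) ^ 2)) with hB
  have hB0 : 0 ≤ B := le_min (sq_nonneg _) (le_min (sq_nonneg _) (by positivity))
  have hB3 : B ≤ I.card * (r * M₀) ^ 2 := (min_le_right _ _).trans (min_le_right _ _)
  -- This `M` makes the squared slope norm exactly `B`, the most that `D`, `G` and `M₀` permit.
  have hM : I.card * (r * (√(B / I.card) / r)) ^ 2 = B := by
    rw [mul_div_cancel₀ _ hr.ne', Real.sq_sqrt (by positivity), mul_div_cancel₀ _ hc.ne']
  have hle : √(B / I.card) / r ≤ M₀ := by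
    rw [div_le_iff₀ hr, Real.sqrt_le_left (by positivity), div_le_iff₀ hc]
    calc B ≤ _ := hB3
      _ = _ := by ring
  have := le_minimaxErrorStr_of_isMask (T := T) (D := D) (G := G) (h _ (by positivity) hle) hμ hp hr
    (by positivity) hTr hG hD (by rw [hM]; exact (min_le_right _ _).trans (min_le_left _ _))
    (by rw [hM]; exact min_le_left _ _)
  rwa [hM] at this

/-- The exponent `a = 2 - 2/p` lies in `[0, 1]`, so the factor `2` in `hm`, lost by rounding, costs
only `2 ^ a ≤ 2`. -/
theorem rate_le {m T : ℕ} {p σs σl : ℝ} (hp : 1 < p) (hp2 : p ≤ 2) (hσs : 0 < σs) (hσl : 0 < σl)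
    (hT : 0 < T) (hm : σl ^ 2 ≤ 2 * (m * σs ^ 2)) :
    σs ^ (4 / p - 2) * σl ^ (4 - 4 / p) / (T : ℝ) ^ (2 - 2 / p)
      ≤ 2 * (σs ^ 2 * ((m : ℝ) / T) ^ (2 - 2 / p)) := by
  have hp0 : 0 < p := by linarith
  have hT' : (0 : ℝ) < T := by exact_mod_cast hT
  set a := 2 - 2 / p with ha
  have ha0 : 0 ≤ a := by
    rw [ha, sub_nonneg, div_le_iff₀ hp0]
    linarith
  have ha1 : a ≤ 1 := by
    have : 1 ≤ 2 / p := (one_le_div hp0).2 hp2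
    linarith
  have e1 : 4 / p - 2 = 2 - 2 * a := by rw [ha]; ring
  have e2 : 4 - 4 / p = 2 * a := by rw [ha]; ring
  have h2a : (2 : ℝ) ^ a ≤ 2 := by
    simpa using Real.rpow_le_rpow_of_exponent_le (x := 2) (by norm_num) ha1
  have hσ : ∀ s : ℝ, 0 < s → s ^ (2 * a) = (s ^ 2) ^ a := fun s hs => by
    rw [Real.rpow_mul hs.le, Real.rpow_two]
  have hl : σl ^ (2 * a) ≤ 2 * ((m : ℝ) ^ a * σs ^ (2 * a)) := by
    rw [hσ σl hσl, hσ σs hσs]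
    calc (σl ^ 2) ^ a ≤ (2 * (m * σs ^ 2)) ^ a := by gcongr
      _ = 2 ^ a * ((m : ℝ) ^ a * (σs ^ 2) ^ a) := by
        rw [Real.mul_rpow (by norm_num) (by positivity), Real.mul_rpow (by positivity) (by positivity)]
      _ ≤ _ := by gcongr
  have hs : σs ^ (2 - 2 * a) * σs ^ (2 * a) = σs ^ 2 := by
    rw [← Real.rpow_add hσs, sub_add_cancel, Real.rpow_two]
  rw [e1, e2, Real.div_rpow (Nat.cast_nonneg _) hT'.le, div_le_iff₀ (by positivity)]
  calc σs ^ (2 - 2 * a) * σl ^ (2 * a)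
      ≤ σs ^ (2 - 2 * a) * (2 * ((m : ℝ) ^ a * σs ^ (2 * a))) := by gcongr
    _ = 2 * ((σs ^ (2 - 2 * a) * σs ^ (2 * a)) * (m : ℝ) ^ a) := by ring
    _ = _ := by
      rw [hs]
      field_simp

/-- The lower bound in terms of the dimension `m` of the estimation problem. -/
theorem le_minimaxErrorStr_of_card {m d T : ℕ} {D μ G p σs σl : ℝ} (hD : 0 < D) (hμ : 0 < μ)
    (hG : 0 < G) (hp : 1 < p) (hp2 : p ≤ 2) (hσs : 0 < σs) (hT : 0 < T) (hm : 0 < m) (hmd : m ≤ d)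
    (hσ : m * σs ^ 2 ≤ σl ^ 2) (hσl : 0 < σl) :
    ENNReal.ofReal (min ((μ * D) ^ 2) (min (G ^ 2)
        (σs ^ 2 * ((m : ℝ) / T) ^ (2 - 2 / p) / 8)) / (4 * μ))
      ≤ minimaxErrorStr d T D μ G p σs σl := by
  have hp0 : 0 < p := by linarith
  have hT' : (1 : ℝ) ≤ T := by exact_mod_cast hT
  have hT0 : (0 : ℝ) < T := by linarith
  have hm' : (0 : ℝ) < m := by exact_mod_cast hm
  have ha1 : 2 - 2 / p ≤ 1 := by
    have : 1 ≤ 2 / p := (one_le_div hp0).2 hp2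
    linarith
  obtain ⟨I, -, hI⟩ := Finset.exists_subset_card_eq
    (s := (Finset.univ : Finset (Fin d))) (n := m) (by simpa using hmd)
  have hσ' : √I.card * σs ≤ σl := by
    rw [hI]
    refine (sq_le_sq₀ (by positivity) hσl.le).1 ?_
    rwa [mul_pow, Real.sq_sqrt hm'.le]
  -- The largest `r` with `T * r ≤ 1 / 2`.
  set r : ℝ := 1 / (2 * T) with hr
  have hr0 : 0 < r := by positivity
  have hTr : T * r = 1 / 2 := by
    rw [hr]
    field_simp
  have hr1 : r ≤ 1 := by nlinarith
  have hmr : m * r = (m : ℝ) / T * (1 / 2) := by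
    rw [hr]
    field_simp
  clear_value r
  have fin : ∀ M₀ : ℝ, σs ^ 2 * ((m : ℝ) / T) ^ (2 - 2 / p) / 8 ≤ m * (r * M₀) ^ 2 →
      ENNReal.ofReal (min ((μ * D) ^ 2) (min (G ^ 2) (I.card * (r * M₀) ^ 2)) / (4 * μ))
        ≤ minimaxErrorStr d T D μ G p σs σl →
      ENNReal.ofReal (min ((μ * D) ^ 2) (min (G ^ 2)
        (σs ^ 2 * ((m : ℝ) / T) ^ (2 - 2 / p) / 8)) / (4 * μ))
      ≤ minimaxErrorStr d T D μ G p σs σl := fun M₀ h h' => by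
    refine le_trans (ENNReal.ofReal_le_ofReal ?_) h'
    rw [hI]
    gcongr
  -- Showing one coordinate at a time needs total probability `m * r ≤ 1`.
  rcases le_or_gt (m * r) 1 with hle | hgt
  · have hprob := singleCoordMask_isProbabilityMeasure (I := I) hr0.le (by rwa [hI])
    -- Solves `(2 * M₀) ^ p * (m * r) = (√m * σs) ^ p`.
    set M₀ : ℝ := √m * σs / 2 * (m * r) ^ (-(1 / p)) with hM₀
    refine fin M₀ ?_ (le_minimaxErrorStr_of_forall_isMask (ν := singleCoordMask I r) (by rwa [hI])
      (fun M hM hMle => isMask_singleCoordMask hr0.le (by rwa [hI]) (by rwa [hI]) hp.le hp2 hM hσs.le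
        hσ' ?_) hμ hp0 hr0 (by positivity) hTr.le hG.le hD.le)
    · have e : m * (r * M₀) ^ 2 = σs ^ 2 / 4 * (m * r) ^ (2 - 2 / p) := by
        have : (m * r) ^ (2 - 2 / p) = (m * r) ^ 2 * ((m * r) ^ (-(1 / p))) ^ 2 := by
          rw [← Real.rpow_two, ← Real.rpow_two, ← Real.rpow_mul (by positivity),
            ← Real.rpow_add (by positivity)]
          congr 1
          ring
        rw [this, hM₀, mul_pow, mul_pow, div_pow, mul_pow, Real.sq_sqrt hm'.le]
        ring
      rw [e, hmr, Real.mul_rpow (by positivity) (by norm_num)]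
      have h12 : (1 / 2 : ℝ) ≤ (1 / 2 : ℝ) ^ (2 - 2 / p) := by
        simpa using Real.rpow_le_rpow_of_exponent_ge (x := 1 / 2) (by norm_num) (by norm_num) ha1
      have hX : 0 ≤ σs ^ 2 / 4 * ((m : ℝ) / T) ^ (2 - 2 / p) := by positivity
      nlinarith
    · have h2M : 2 * M ≤ √m * σs * (m * r) ^ (-(1 / p)) := by linarith
      rw [hI]
      calc (2 * M) ^ p * (m * r) ≤ (√m * σs * (m * r) ^ (-(1 / p))) ^ p * (m * r) := by
            gcongr
        _ = (√m * σs) ^ p * ((m * r)⁻¹ * (m * r)) := by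
            rw [Real.mul_rpow (by positivity) (by positivity), ← Real.rpow_mul (by positivity),
              neg_mul, one_div_mul_cancel hp0.ne', Real.rpow_neg_one, mul_assoc]
        _ = _ := by rw [inv_mul_cancel₀ (by positivity), mul_one]
  · have hprob := bernoulliMask_isProbabilityMeasure (d := d) hr0.le hr1
    refine fin (σs / √r) ?_ (le_minimaxErrorStr_of_forall_isMask (ν := bernoulliMask d r)
      (by rwa [hI]) (fun M hM hMle => isMask_bernoulliMask hr0.le hr1 hp0 hp2 hσs.le hσ' ?_) hμ hp0
      hr0 (by positivity) hTr.le hG.le hD.le)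
    · have e : m * (r * (σs / √r)) ^ 2 = σs ^ 2 * ((m : ℝ) / T * (1 / 2)) := by
        rw [← hmr, mul_pow, div_pow, Real.sq_sqrt hr0.le]
        field_simp
      rw [e]
      -- Here `m / T` exceeds `1` and the exponent is at most `1`, so the variance rate `m / T`
      -- already dominates.
      have h1 : ((m : ℝ) / T) ^ (2 - 2 / p) ≤ (m : ℝ) / T := by
        have : 1 ≤ (m : ℝ) / T := by linarith
        simpa using Real.rpow_le_rpow_of_exponent_le this ha1
      have h2 : σs ^ 2 * ((m : ℝ) / T) ^ (2 - 2 / p) ≤ σs ^ 2 * ((m : ℝ) / T) := by gcongr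
      have h3 : 0 ≤ σs ^ 2 * ((m : ℝ) / T) := by positivity
      linarith
    · calc r * M ^ 2 ≤ r * (σs / √r) ^ 2 := by gcongr
        _ = σs ^ 2 := by
          rw [div_pow, Real.sq_sqrt hr0.le, mul_div_cancel₀ _ hr0.ne']

end HeavyTailLB

theorem mainTheorem6 :
    ∃ c : ℝ, 0 < c ∧
      ∀ (D μ G p σs σl : ℝ) (d T : ℕ),
        0 < D → 0 < μ → 0 < G → 1 < p → p ≤ 2 → 0 < σs → σs ≤ σl →
        σl ^ 2 / σs ^ 2 ≤ (d : ℝ) → 1 ≤ T →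
        ENNReal.ofReal
            (c * min (μ * D ^ 2) (min (G ^ 2 / μ)
              (σs ^ (4 / p - 2) * σl ^ (4 - 4 / p) / (μ * (T : ℝ) ^ (2 - 2 / p)))))
          ≤ HeavyTailLB.minimaxErrorStr d T D μ G p σs σl := by
  -- `64 = 4 * 8 * 2`: the `4 * μ` and the `8` of `le_minimaxErrorStr_of_card`, and the `2` of
  -- `rate_le`.
  refine ⟨1 / 64, by norm_num, fun D μ G p σs σl d T hD hμ hG hp hp2 hσs hσ hd hT => ?_⟩
  have hσl : 0 < σl := hσs.trans_le hσ
  set q := σl ^ 2 / σs ^ 2 with hq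
  have hq1 : 1 ≤ q := (one_le_div (by positivity)).2 (by gcongr)
  -- As `q ≥ 1`, rounding down to an admissible dimension loses at most a factor `2`.
  have hm1 : 1 ≤ ⌊q⌋₊ := Nat.le_floor (by simpa using hq1)
  have hm1' : (1 : ℝ) ≤ ⌊q⌋₊ := by exact_mod_cast hm1
  have hqσ : q * σs ^ 2 = σl ^ 2 := div_mul_cancel₀ _ (by positivity)
  have hle : (⌊q⌋₊ : ℝ) * σs ^ 2 ≤ σl ^ 2 := by
    rw [← hqσ]
    gcongr
    exact Nat.floor_le (by linarith)
  have hge : σl ^ 2 ≤ 2 * (⌊q⌋₊ * σs ^ 2) := by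
    rw [← hqσ, ← mul_assoc]
    gcongr
    linarith [Nat.lt_floor_add_one q]
  refine le_trans (ENNReal.ofReal_le_ofReal ?_) (HeavyTailLB.le_minimaxErrorStr_of_card hD hμ hG hp
    hp2 hσs hT hm1 (Nat.floor_le_of_le hd) hle hσl)
  have hrate := HeavyTailLB.rate_le hp hp2 hσs hσl hT hge
  set X := σs ^ 2 * ((⌊q⌋₊ : ℝ) / T) ^ (2 - 2 / p)
  rw [le_div_iff₀ (by positivity)]
  have h1 : μ * (μ * D ^ 2) = (μ * D) ^ 2 := by ring
  have h2 : μ * (G ^ 2 / μ) = G ^ 2 := mul_div_cancel₀ _ hμ.ne'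
  have h3 : μ * (σs ^ (4 / p - 2) * σl ^ (4 - 4 / p) / (μ * (T : ℝ) ^ (2 - 2 / p))) ≤ 2 * X := by
    refine le_of_eq_of_le ?_ hrate
    rw [mul_div_assoc', mul_div_mul_left _ _ hμ.ne']
  set m := min (μ * D ^ 2) (min (G ^ 2 / μ)
    (σs ^ (4 / p - 2) * σl ^ (4 - 4 / p) / (μ * (T : ℝ) ^ (2 - 2 / p)))) with hm
  have hm0 : 0 ≤ μ * m := mul_nonneg hμ.le (le_min (by positivity) (le_min (by positivity)
    (by positivity)))
  have k1 : μ * m ≤ μ * (μ * D ^ 2) := mul_le_mul_of_nonneg_left (min_le_left _ _) hμ.le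
  have k2 : μ * m ≤ μ * (G ^ 2 / μ) :=
    mul_le_mul_of_nonneg_left ((min_le_right _ _).trans (min_le_left _ _)) hμ.le
  have k3 := mul_le_mul_of_nonneg_left ((min_le_right _ _).trans (min_le_right _ _) : m ≤ _) hμ.le
  refine le_min ?_ (le_min ?_ ?_) <;> linarith
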